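/- Let $g\in C^2(\mathbb R)$ be bounded and strictly increasing with $g(0)=0$, strictly concave on $(0,+\infty)$ and strictly convex on $(-\infty,0)$; put $g_\pm=\lim_{s\to\pm\infty}g(s)$ and $G(s)=\int_0^s g$. Say that $q\in L^\infty(\mathbb R)$ has asymptotic average $A$ if $\frac1T\int_t^{t+T}q\to A$ as $T\to+\infty$, uniformly in $t\in\mathbb R$. Let $p:\mathbb R\to\mathbb R$ be bounded and continuous with asymptotic average $A(p)$, where $g_-<A(p)<g_+$. For $q\in L^\infty(\mathbb R)$ and $\varepsilon\in(0,1)$, an $\varepsilon$-decomposition of $q$ is an identity $q=q_1+\dot q_2$ (weak derivative) with $q_1,q_2\in L^\infty(\mathbb R)$ and $\|q_1-A(p)\|_\infty<\varepsilon/2$. Then $p$ has an $\varepsilon$-decomposition for every $\varepsilon\in(0,1)$. Fix any choice $p=p_{1,\varepsilon}+\dot p_{2,\varepsilon}$, $\varepsilon\in(0,1)$, of such decompositions, and let $\mathcal P$ be the set of all $q\in L^\infty(\mathbb R)$ with $\|q\|_\infty<\|p\|_\infty+1$ and asymptotic average $A(p)$ which for every $\varepsilon\in(0,1)$ have an $\varepsilon$-decomposition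 $q=q_{1,\varepsilon}+\dot q_{2,\varepsilon}$ with $\|q_{2,\varepsilon}\|_\infty<\|p_{2,\varepsilon}\|_\infty+1$. For $a<b$ and $q\in\mathcal P$ consider $$J_{(a,b),q}(u)=\int_a^b\Big[\tfrac12\dot u^2(t)-G(u(t))+q(t)u(t)\Big]\,dt\qquad\text{on } H^1_0(a,b)^+=\{u\in H^1_0(a,b):u\ge0\}.$$ There is $\tilde L>0$ such that (T) for all $a,b$ with $b-a\ge\tilde L$ and all $q\in\mathcal P$, every minimizer of $J_{(a,b),q}$ in $H^1_0(a,b)^+$ is strictly positive in $(a,b)$. Moreover, for every $\tilde L>0$ satisfying (T) and all $a,b$ with $b-a\ge\tilde L$: the functional $J_{(a,b),p}$ has exactly one minimizer $u=u(\cdot\,;a,b;p)$ in $H^1_0(a,b)^+$; $u$ is a classical solution of $\ddot u+g(u)=p$ in $(a,b)$, $u(a)=0=u(b)$, $u>0$ in $(a,b)$; and $u$ is non-degenerate, that is, the linearized Dirichlet problem $$\ddot\psi(t)+g'(u(t))\psi(t)=0\ \text{ in }(a,b),\qquad \psi(a)=0=\psi(b),$$ has only the trivial solution $\psi\equiv0$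 in $H^2(a,b)\cap H^1_0(a,b)$. -/

import Mathlib

open Set Filter Topology MeasureTheory
open scoped ENNReal

namespace DualNehari

/-- Hypotheses on the nonlinearity: `g(0) = 0`, `g` is `C²`, bounded, strictly increasing,
strictly concave on `(0,∞)` and strictly convex on `(-∞,0)`. -/
structure IsSaturating (g : ℝ → ℝ) : Prop where
  zero : g 0 = 0
  contDiff : ContDiff ℝ 2 g
  bounded : ∃ C : ℝ, ∀ s, |g s| ≤ C
  strictMono : StrictMono g
  strictConcave : StrictConcaveOn ℝ (Ioi 0) g
  strictConvex : StrictConvexOn ℝ (Iio 0) g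

/-- `q` has asymptotic average `A`: the means over `(t, t + T)` converge to `A` as `T → ∞`,
uniformly in `t`. -/
def HasAsymptoticAverage (q : ℝ → ℝ) (A : ℝ) : Prop :=
  TendstoUniformly (fun T t : ℝ => (1 / T) * ∫ s in t..(t + T), q s) (fun _ => A) atTop

/-- `q = q₁ + q̇₂` with `q₁, q₂ ∈ L^∞(ℝ)` and `‖q₁ - A‖_∞ < ε / 2`. As `q̇₂ = q - q₁` is bounded,
`q₂` is taken to be its Lipschitz representative, and `q̇₂` is the weak derivative. -/
structure IsDecomposition (q : ℝ → ℝ) (A ε : ℝ) (q₁ q₂ : ℝ → ℝ) : Prop where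
  memLp_fst : MemLp q₁ ∞ volume
  memLp_snd : MemLp q₂ ∞ volume
  close : eLpNorm (fun t => q₁ t - A) ∞ volume < ENNReal.ofReal (ε / 2)
  primitive : ∀ s t : ℝ, q₂ t - q₂ s = ∫ x in s..t, (q x - q₁ x)

/-- A choice, for every `ε ∈ (0,1)`, of a decomposition of `p`. -/
def IsDecompositionFamily (p : ℝ → ℝ) (A : ℝ) (p₁ p₂ : ℝ → ℝ → ℝ) : Prop :=
  ∀ ε ∈ Ioo (0 : ℝ) 1, IsDecomposition p A ε (p₁ ε) (p₂ ε)

/-- The class `𝒫` of forcing terms attached to `p`, its average `A`, and the chosen bounded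
parts `p₂ ε`; here `M₁ = ‖p‖_∞ + 1` and `M_ε = ‖p₂ ε‖_∞ + 1`. -/
def forcingClass (p : ℝ → ℝ) (A : ℝ) (p₂ : ℝ → ℝ → ℝ) : Set (ℝ → ℝ) :=
  {q | MemLp q ∞ volume ∧ eLpNorm q ∞ volume < eLpNorm p ∞ volume + 1 ∧
    HasAsymptoticAverage q A ∧
    ∀ ε ∈ Ioo (0 : ℝ) 1, ∃ q₁ q₂ : ℝ → ℝ, IsDecomposition q A ε q₁ q₂ ∧
      eLpNorm q₂ ∞ volume < eLpNorm (p₂ ε) ∞ volume + 1}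

/-- `H¹(a,b)`, through continuous representatives on `[a,b]`: absolutely continuous functions
whose derivative is square integrable. -/
def MemH1 (a b : ℝ) (u : ℝ → ℝ) : Prop :=
  AbsolutelyContinuousOnInterval u a b ∧ MemLp (deriv u) 2 (volume.restrict (Ioo a b))

/-- `H¹₀(a,b)`. -/
def MemH10 (a b : ℝ) (u : ℝ → ℝ) : Prop :=
  MemH1 a b u ∧ u a = 0 ∧ u b = 0

/-- `H²(a,b)`: continuous on `[a,b]`, and the derivative in `(a,b)` extends to a function
of class `H¹`. -/
def MemH2 (a b : ℝ) (u : ℝ → ℝ) : Prop :=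
  ContinuousOn u (Icc a b) ∧ ∃ w : ℝ → ℝ, MemH1 a b w ∧ ∀ t ∈ Ioo a b, HasDerivAt u (w t) t

/-- The cone `H¹₀(a,b)⁺`. -/
def H10plus (a b : ℝ) : Set (ℝ → ℝ) :=
  {u | MemH10 a b u ∧ ∀ t ∈ Icc a b, 0 ≤ u t}

/-- The action functional `∫ₐᵇ (u̇² / 2 - G(u) + q u)`, where `G(s) = ∫₀ˢ g`. -/
noncomputable def action (g q : ℝ → ℝ) (a b : ℝ) (u : ℝ → ℝ) : ℝ :=
  ∫ t in a..b, ((1 / 2) * (deriv u t) ^ 2 - (∫ s in (0 : ℝ)..(u t), g s) + q t * u t)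

/-- `u` minimizes the action in `H¹₀(a,b)⁺`. -/
def IsNonnegMinimizer (g q : ℝ → ℝ) (a b : ℝ) (u : ℝ → ℝ) : Prop :=
  u ∈ H10plus a b ∧ ∀ v ∈ H10plus a b, action g q a b u ≤ action g q a b v

/-- `L` is a threshold length for the class `𝒬` of forcing terms: on every interval of length
at least `L`, for every forcing term in `𝒬`, all nonnegative minimizers are positive inside. -/
def IsThreshold (g : ℝ → ℝ) (𝒬 : Set (ℝ → ℝ)) (L : ℝ) : Prop :=
  0 < L ∧ ∀ a b : ℝ, L ≤ b - a → ∀ q ∈ 𝒬, ∀ u : ℝ → ℝ, IsNonnegMinimizer g q a b u →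
    ∀ t ∈ Ioo a b, 0 < u t

/-- `u` is a classical solution of `ü + g(u) = p` in `(a,b)`, `u(a) = 0 = u(b)`, `u > 0` in
`(a,b)`. -/
def SolvesPositiveBVP (g p : ℝ → ℝ) (a b : ℝ) (u : ℝ → ℝ) : Prop :=
  ContinuousOn u (Icc a b) ∧ ContDiffOn ℝ 2 u (Ioo a b) ∧
    (∀ t ∈ Ioo a b, deriv (deriv u) t + g (u t) = p t) ∧
    u a = 0 ∧ u b = 0 ∧ ∀ t ∈ Ioo a b, 0 < u t

/-- `u` is non-degenerate: the linearized Dirichlet problem `ψ̈ + g'(u) ψ = 0` has only the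
trivial solution in `H²(a,b) ∩ H¹₀(a,b)`. -/
def IsNondegenerate (g : ℝ → ℝ) (a b : ℝ) (u : ℝ → ℝ) : Prop :=
  ∀ ψ : ℝ → ℝ, MemH2 a b ψ → MemH10 a b ψ →
    (∀ᵐ t ∂(volume.restrict (Ioo a b)), deriv (deriv ψ) t + deriv g (u t) * ψ t = 0) →
    ∀ t ∈ Icc a b, ψ t = 0

end DualNehari

open DualNehari

/-! Uniqueness and non-degeneracy rest on a comparison with a slightly larger force. Let `u`
minimize for `p` and `v` for `p + δ`, with `δ > 0` small. On `[a,b]` the force `p + δ` agrees with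
`p + δ χ` (`χ` the indicator of `[a,b]`), which still lies in the forcing class because the defining
norm bounds are strict (`add_indicator_mem_forcingClass`); the threshold property therefore makes
`v` positive too. Exchanging `u` and `v` over an arch where `v > u` shows `v ≤ u`
(`le_of_add_const`).

Now `w = u - v ≥ 0` satisfies `ẅ + (g(u) - g(v)) = -δ`, and concavity of `g` on the positive axis
gives `g(u) - g(v) ≥ g'(u) w`. So `w` is a nonnegative strict supersolution of the linearized
equation, and Sturm comparison (`false_of_positive_arch`) forbids any kernel element with a positive
arch. For a second minimizer `u₁` the same argument applies to `u₁ - u` where it is positive: there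
`v ≤ u ≤ u₁`, and the slopes of `g` decrease along these three points. This yields `u₁ ≤ u`, and
uniqueness by symmetry.

A threshold exists by scaling. On an interval of length `l` the action differs from that of the
constant force problem, `∫ (u̇²/2 - κ u)` with `κ = gplus - A`, by `o(l³)` on functions of energy
`O(l³)`, uniformly over the class: `G` is asymptotically linear and the oscillating part of `q` is a
derivative with bounded primitive. Minimizers are thus within `o(l²)` of a parabola
(`exists_length_abs_sub_parabola_le`). An interior zero would leave a long interval on one side,
where the parabola grows linearly from the zero, whereas a nonnegative minimizer grows at most
quadratically there (`le_of_zero`).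

Existence is the direct method, and regularity follows from first variations along piecewise linear
tents. -/

/-! ### Calculus of functions with a square integrable derivative -/

/-- `u` has the square integrable derivative `f` on `[a,b]`. -/
structure HasL2Deriv (a b : ℝ) (u f : ℝ → ℝ) : Prop where
  memLp : MemLp f 2 (volume.restrict (Ioo a b))
  eq_integral : ∀ t ∈ Icc a b, u t = u a + ∫ s in a..t, f s

namespace HasL2Deriv

variable {a b : ℝ} {u f v h : ℝ → ℝ}

theorem integrableOn (hu : HasL2Deriv a b u f) : IntegrableOn f (Ioc a b) := by
  rw [integrableOn_Ioc_iff_integrableOn_Ioo]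
  exact hu.memLp.integrable (by norm_num)

theorem intervalIntegrable (hu : HasL2Deriv a b u f) {s t : ℝ} (hs : s ∈ Icc a b)
    (ht : t ∈ Icc a b) : IntervalIntegrable f volume s t := by
  have hab : a ≤ b := hs.1.trans hs.2
  have : IntervalIntegrable f volume a b :=
    (intervalIntegrable_iff_integrableOn_Ioc_of_le hab).2 hu.integrableOn
  exact this.mono_set (by rw [uIcc_of_le hab]; exact uIcc_subset_Icc hs ht)

theorem sub_eq (hu : HasL2Deriv a b u f) {s t : ℝ} (hs : s ∈ Icc a b) (ht : t ∈ Icc a b) :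
    u t - u s = ∫ x in s..t, f x := by
  have ha : a ∈ Icc a b := ⟨le_rfl, hs.1.trans hs.2⟩
  rw [hu.eq_integral t ht, hu.eq_integral s hs,
    ← intervalIntegral.integral_interval_sub_left (hu.intervalIntegrable ha ht)
      (hu.intervalIntegrable ha hs)]
  ring

theorem mono (hu : HasL2Deriv a b u f) {α β : ℝ} (hα : a ≤ α) (hβ : β ≤ b) :
    HasL2Deriv α β u f where
  memLp := hu.memLp.mono_measure (Measure.restrict_mono (Ioo_subset_Ioo hα hβ) le_rfl)
  eq_integral t ht := by
    rw [← hu.sub_eq ⟨hα, ht.1.trans (ht.2.trans hβ)⟩ ⟨hα.trans ht.1, ht.2.trans hβ⟩]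
    ring

theorem congr (hu : HasL2Deriv a b u f) (huv : EqOn v u (Icc a b)) (hfh : EqOn h f (Ioo a b)) :
    HasL2Deriv a b v h where
  memLp := hu.memLp.ae_eq <| (ae_restrict_mem measurableSet_Ioo).mono fun t ht => (hfh ht).symm
  eq_integral t ht := by
    rw [huv ht, huv ⟨le_rfl, ht.1.trans ht.2⟩, hu.eq_integral t ht]
    congr 1
    refine intervalIntegral.integral_congr_ae ?_
    have hb : ∀ᵐ x : ℝ, x ≠ b := by simp [ae_iff, measure_singleton]
    filter_upwards [hb] with x hx hxt
    rw [uIoc_of_le ht.1] at hxt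
    exact (hfh ⟨hxt.1, lt_of_le_of_ne (hxt.2.trans ht.2) hx⟩).symm

theorem concat {c : ℝ} (hac : a ≤ c) (hcb : c ≤ b) (h₁ : HasL2Deriv a c u f)
    (h₂ : HasL2Deriv c b u f) : HasL2Deriv a b u f where
  memLp := by
    have h1 : MemLp f 2 (volume.restrict (Ioc a c)) := by
      rw [← restrict_Ioo_eq_restrict_Ioc]; exact h₁.memLp
    have h2 : MemLp f 2 (volume.restrict (Ioc c b)) := by
      rw [← restrict_Ioo_eq_restrict_Ioc]; exact h₂.memLp
    have hm := aestronglyMeasurable_union_iff.2 ⟨h1.aestronglyMeasurable, h2.aestronglyMeasurable⟩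
    rw [restrict_Ioo_eq_restrict_Ioc, ← Ioc_union_Ioc_eq_Ioc hac hcb,
      memLp_two_iff_integrable_sq hm]
    exact IntegrableOn.union h1.integrable_sq h2.integrable_sq
  eq_integral t ht := by
    rcases le_total t c with htc | hct
    · exact h₁.eq_integral t ⟨ht.1, htc⟩
    · rw [h₂.eq_integral t ⟨hct, ht.2⟩, h₁.eq_integral c ⟨hac, le_rfl⟩, add_assoc,
        intervalIntegral.integral_add_adjacent_intervals
          (h₁.intervalIntegrable ⟨le_rfl, hac⟩ ⟨hac, le_rfl⟩)
          (h₂.intervalIntegrable ⟨le_rfl, hcb⟩ ⟨hct, ht.2⟩)]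

theorem continuousOn (hu : HasL2Deriv a b u f) : ContinuousOn u (Icc a b) := by
  rcases le_or_gt a b with hab | hab
  · have h := intervalIntegral.continuousOn_primitive_interval (μ := volume) (f := f) (a := a)
      (b := b) (by
        rw [uIcc_of_le hab, integrableOn_Icc_iff_integrableOn_Ioc]; exact hu.integrableOn)
    rw [uIcc_of_le hab] at h
    exact (continuousOn_const.add h).congr hu.eq_integral
  · simp [Icc_eq_empty hab.not_ge]

theorem absolutelyContinuous (hab : a ≤ b) (hu : HasL2Deriv a b u f) :
    AbsolutelyContinuousOnInterval u a b := by
  have h1 := (hu.intervalIntegrable (left_mem_Icc.2 hab)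
    (right_mem_Icc.2 hab)).absolutelyContinuousOnInterval_intervalIntegral (c := a) left_mem_uIcc
  have h2 : AbsolutelyContinuousOnInterval (fun _ : ℝ => u a) a b :=
    ((LipschitzWith.const (u a)).lipschitzOnWith).absolutelyContinuousOnInterval
  have h3 := h2.add h1
  -- Only values on `[a,b]` enter the definition, and there `u` coincides with the primitive.
  rw [absolutelyContinuousOnInterval_iff] at h3 ⊢
  intro ε hε
  obtain ⟨δ, hδ, H⟩ := h3 ε hε
  refine ⟨δ, hδ, fun E hE hlen => ?_⟩
  refine lt_of_eq_of_lt (Finset.sum_congr rfl fun i hi => ?_) (H E hE hlen)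
  have := hE.1 i hi
  rw [uIcc_of_le hab] at this
  simp only [Pi.add_apply]
  rw [hu.eq_integral _ this.1, hu.eq_integral _ this.2]

theorem deriv_ae_eq (hab : a ≤ b) (hu : HasL2Deriv a b u f) :
    deriv u =ᵐ[volume.restrict (Ioo a b)] f := by
  have h1 := (hu.intervalIntegrable (left_mem_Icc.2 hab)
    (right_mem_Icc.2 hab)).ae_hasDerivAt_integral
  rw [Filter.EventuallyEq, ae_restrict_iff' measurableSet_Ioo]
  filter_upwards [h1] with x hx hxab
  have h2 := hx (by rw [uIcc_of_le hab]; exact Ioo_subset_Icc_self hxab) a left_mem_uIcc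
  have h3 : HasDerivAt u (f x) x := by
    refine (h2.const_add (u a)).congr_of_eventuallyEq ?_
    filter_upwards [Ioo_mem_nhds hxab.1 hxab.2] with y hy
    exact hu.eq_integral y (Ioo_subset_Icc_self hy)
  exact h3.deriv

theorem memH1 (hab : a ≤ b) (hu : HasL2Deriv a b u f) : MemH1 a b u :=
  ⟨hu.absolutelyContinuous hab, hu.memLp.ae_eq (hu.deriv_ae_eq hab).symm⟩

theorem of_memH1 (hab : a ≤ b) (hu : MemH1 a b u) : HasL2Deriv a b u (deriv u) where
  memLp := hu.2
  eq_integral t ht := by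
    have h := (hu.1.mono (c := a) (d := t) (by
      rw [uIcc_of_le hab, uIcc_of_le ht.1]; exact Icc_subset_Icc le_rfl ht.2))
    rw [h.integral_deriv_eq_sub]
    ring

theorem add (hu : HasL2Deriv a b u f) (hv : HasL2Deriv a b v h) :
    HasL2Deriv a b (fun t => u t + v t) (fun t => f t + h t) where
  memLp := hu.memLp.add hv.memLp
  eq_integral t ht := by
    have ha : a ∈ Icc a b := ⟨le_rfl, ht.1.trans ht.2⟩
    rw [intervalIntegral.integral_add (hu.intervalIntegrable ha ht) (hv.intervalIntegrable ha ht),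
      hu.eq_integral t ht, hv.eq_integral t ht]
    ring

theorem const_mul (c : ℝ) (hu : HasL2Deriv a b u f) :
    HasL2Deriv a b (fun t => c * u t) (fun t => c * f t) where
  memLp := hu.memLp.const_mul c
  eq_integral t ht := by
    rw [intervalIntegral.integral_const_mul, hu.eq_integral t ht]
    ring

theorem sub (hu : HasL2Deriv a b u f) (hv : HasL2Deriv a b v h) :
    HasL2Deriv a b (fun t => u t - v t) (fun t => f t - h t) :=
  (hu.add (hv.const_mul (-1))).congr (fun t _ => by ring) (fun t _ => by ring)

/-- A function with a continuous derivative on `[a,b]` has that derivative in the `L²` sense. -/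
theorem of_hasDerivAt (hu : ContinuousOn u (Icc a b)) (hf : ContinuousOn f (Icc a b))
    (hd : ∀ t ∈ Ioo a b, HasDerivAt u (f t) t) : HasL2Deriv a b u f where
  memLp := by
    obtain ⟨C, hC⟩ := isCompact_Icc.exists_bound_of_continuousOn hf
    refine MemLp.of_bound ((hf.mono Ioo_subset_Icc_self).aestronglyMeasurable measurableSet_Ioo) C
      ((ae_restrict_mem measurableSet_Ioo).mono fun t ht => hC t (Ioo_subset_Icc_self ht))
  eq_integral t ht := by
    rw [intervalIntegral.integral_eq_sub_of_hasDerivAt_of_le ht.1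
      (hu.mono (Icc_subset_Icc le_rfl ht.2)) (fun x hx => hd x ⟨hx.1, hx.2.trans_le ht.2⟩)
      ((hf.mono (by rw [uIcc_of_le ht.1]; exact Icc_subset_Icc le_rfl ht.2)).intervalIntegrable)]
    ring

theorem intervalIntegrable_sq (hab : a ≤ b) (hu : HasL2Deriv a b u f) :
    IntervalIntegrable (fun t => f t ^ 2) volume a b := by
  rw [intervalIntegrable_iff_integrableOn_Ioc_of_le hab, integrableOn_Ioc_iff_integrableOn_Ioo]
  exact hu.memLp.integrable_sq

theorem intervalIntegrable_mul (hab : a ≤ b) (hu : HasL2Deriv a b u f) (hv : HasL2Deriv a b v h) :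
    IntervalIntegrable (fun t => f t * h t) volume a b := by
  rw [intervalIntegrable_iff_integrableOn_Ioc_of_le hab, integrableOn_Ioc_iff_integrableOn_Ioo]
  exact hu.memLp.integrable_mul hv.memLp

/-- Integration by parts. -/
theorem integral_mul_eq (hab : a ≤ b) (hu : HasL2Deriv a b u f) (hv : HasL2Deriv a b v h) :
    ∫ t in a..b, u t * h t = u b * v b - u a * v a - ∫ t in a..b, f t * v t := by
  have key := (hu.absolutelyContinuous hab).integral_mul_deriv_eq_deriv_mul
    (hv.absolutelyContinuous hab)
  have e1 : ∫ t in a..b, u t * h t = ∫ t in a..b, u t * deriv v t := by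
    rw [intervalIntegral.integral_of_le hab, intervalIntegral.integral_of_le hab,
      ← restrict_Ioo_eq_restrict_Ioc]
    refine integral_congr_ae ?_
    filter_upwards [hv.deriv_ae_eq hab] with t ht
    rw [ht]
  have e2 : ∫ t in a..b, f t * v t = ∫ t in a..b, deriv u t * v t := by
    rw [intervalIntegral.integral_of_le hab, intervalIntegral.integral_of_le hab,
      ← restrict_Ioo_eq_restrict_Ioc]
    refine integral_congr_ae ?_
    filter_upwards [hu.deriv_ae_eq hab] with t ht
    rw [ht]
  rw [e1, e2, key]

/-- The inequality `|x| ≤ (c + x²/c)/2`, integrated. The free weight `c` replaces Cauchy–Schwarz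
without square roots; each use tunes it to the expected size of `f`. -/
theorem integral_abs_le (hab : a ≤ b) (hu : HasL2Deriv a b u f) {c : ℝ} (hc : 0 < c) :
    ∫ t in a..b, |f t| ≤ (c * (b - a) + (∫ t in a..b, f t ^ 2) / c) / 2 := by
  have hi := hu.intervalIntegrable (left_mem_Icc.2 hab) (right_mem_Icc.2 hab)
  have hs := hu.intervalIntegrable_sq hab
  have : ∫ t in a..b, |f t| ≤ ∫ t in a..b, (c / 2 + 1 / (2 * c) * f t ^ 2) := by
    refine intervalIntegral.integral_mono_on hab hi.abs
      (intervalIntegrable_const.add (hs.const_mul _)) fun t _ => ?_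
    have h0 : 0 ≤ (|f t| - c) ^ 2 / (2 * c) := by positivity
    have h1 : (|f t| - c) ^ 2 / (2 * c) = c / 2 + 1 / (2 * c) * f t ^ 2 - |f t| := by
      rw [sub_sq, sq_abs]; field_simp; ring
    linarith
  refine this.trans (le_of_eq ?_)
  rw [intervalIntegral.integral_add intervalIntegrable_const (hs.const_mul _),
    intervalIntegral.integral_const_mul, intervalIntegral.integral_const, smul_eq_mul]
  field_simp

theorem abs_le (hu : HasL2Deriv a b u f) (ha : u a = 0) {t : ℝ} (ht : t ∈ Icc a b) :
    |u t| ≤ ∫ s in a..b, |f s| := by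
  have hab : a ≤ b := ht.1.trans ht.2
  rw [hu.eq_integral t ht, ha, zero_add]
  refine (intervalIntegral.abs_integral_le_integral_abs ht.1).trans ?_
  exact intervalIntegral.integral_mono_interval le_rfl ht.1 ht.2
    (Eventually.of_forall fun x => abs_nonneg _)
    (hu.intervalIntegrable (left_mem_Icc.2 hab) (right_mem_Icc.2 hab)).abs

end HasL2Deriv

/-! ### The potential and the Lagrangian -/

/-- The potential `G(s) = ∫₀ˢ g`. -/
noncomputable def potential (g : ℝ → ℝ) (x : ℝ) : ℝ := ∫ s in (0 : ℝ)..x, g s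

theorem hasDerivAt_potential {g : ℝ → ℝ} (hg : Continuous g) (x : ℝ) :
    HasDerivAt (potential g) (g x) x :=
  intervalIntegral.integral_hasDerivAt_right (hg.intervalIntegrable _ _)
    (hg.stronglyMeasurableAtFilter _ _) hg.continuousAt

theorem continuous_potential {g : ℝ → ℝ} (hg : Continuous g) : Continuous (potential g) :=
  continuous_iff_continuousAt.2 fun x => (hasDerivAt_potential hg x).continuousAt

theorem abs_potential_sub_le {g : ℝ → ℝ} (hg : Continuous g) {C : ℝ} (hC : ∀ s, |g s| ≤ C)
    (x y : ℝ) : |potential g x - potential g y| ≤ C * |x - y| := by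
  unfold potential
  rw [intervalIntegral.integral_interval_sub_left (hg.intervalIntegrable _ _)
    (hg.intervalIntegrable _ _)]
  exact intervalIntegral.norm_integral_le_of_norm_le_const (a := y) (b := x) (f := g)
    fun s _ => hC s

theorem potential_zero (g : ℝ → ℝ) : potential g 0 = 0 := by simp [potential]

/-- The potential of an increasing function is convex. -/
theorem potential_add_mul_le {g : ℝ → ℝ} (hg : Continuous g) (hm : Monotone g) (x y : ℝ) :
    potential g x + g x * (y - x) ≤ potential g y := by
  have h : potential g y - potential g x = ∫ s in x..y, g s := by
    unfold potential
    rw [intervalIntegral.integral_interval_sub_left (hg.intervalIntegrable _ _)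
      (hg.intervalIntegrable _ _)]
  rcases le_total x y with hxy | hxy
  · have := intervalIntegral.integral_mono_on hxy (intervalIntegrable_const (c := g x) (μ := volume))
      (hg.intervalIntegrable x y) (fun s hs => hm hs.1)
    rw [intervalIntegral.integral_const, smul_eq_mul] at this
    linarith
  · have := intervalIntegral.integral_mono_on hxy (hg.intervalIntegrable y x)
      (intervalIntegrable_const (c := g x) (μ := volume)) (fun s hs => hm hs.2)
    rw [intervalIntegral.integral_const, smul_eq_mul] at this
    rw [intervalIntegral.integral_symm] at h
    linarith

/-- The Lagrangian density of the action. -/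
noncomputable def lagrangian (g q u f : ℝ → ℝ) (t : ℝ) : ℝ :=
  (1 / 2) * f t ^ 2 - potential g (u t) + q t * u t

theorem intervalIntegrable_of_memLp_top {q : ℝ → ℝ} (hq : MemLp q ∞ volume) (a b : ℝ) :
    IntervalIntegrable q volume a b := by
  have := (hq.locallyIntegrable (by simp)).integrableOn_isCompact (isCompact_uIcc (a := a) (b := b))
  exact (intervalIntegrable_iff.2 (this.mono_set uIoc_subset_uIcc))

/-! ### The action and its localization to subintervals -/

section action

variable {g q : ℝ → ℝ} {a b : ℝ} {u f v h : ℝ → ℝ}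

theorem HasL2Deriv.intervalIntegrable_force (hu : HasL2Deriv a b u f) (hab : a ≤ b)
    (hq : MemLp q ∞ volume) : IntervalIntegrable (fun t => q t * u t) volume a b :=
  (intervalIntegrable_of_memLp_top hq a b).mul_continuousOn
    (by rw [uIcc_of_le hab]; exact hu.continuousOn)

theorem HasL2Deriv.intervalIntegrable_potential (hu : HasL2Deriv a b u f) (hab : a ≤ b)
    (hg : Continuous g) : IntervalIntegrable (fun t => potential g (u t)) volume a b := by
  refine ContinuousOn.intervalIntegrable ?_
  rw [uIcc_of_le hab]
  exact (continuous_potential hg).comp_continuousOn hu.continuousOn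

theorem HasL2Deriv.intervalIntegrable_lagrangian (hu : HasL2Deriv a b u f) (hab : a ≤ b)
    (hg : Continuous g) (hq : MemLp q ∞ volume) :
    IntervalIntegrable (lagrangian g q u f) volume a b :=
  (((hu.intervalIntegrable_sq hab).const_mul _).sub (hu.intervalIntegrable_potential hab hg)).add
    (hu.intervalIntegrable_force hab hq)

theorem HasL2Deriv.action_eq (hu : HasL2Deriv a b u f) (hab : a ≤ b) :
    action g q a b u = ∫ t in a..b, lagrangian g q u f t := by
  unfold action
  rw [intervalIntegral.integral_of_le hab, intervalIntegral.integral_of_le hab,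
    ← restrict_Ioo_eq_restrict_Ioc]
  refine integral_congr_ae ?_
  filter_upwards [hu.deriv_ae_eq hab] with t ht
  simp only [lagrangian, potential, ht]

theorem HasL2Deriv.action_eq_add (hu : HasL2Deriv a b u f) (hab : a ≤ b)
    (hg : Continuous g) (hq : MemLp q ∞ volume) :
    action g q a b u = (1 / 2) * (∫ t in a..b, f t ^ 2) - (∫ t in a..b, potential g (u t)) +
      ∫ t in a..b, q t * u t := by
  rw [hu.action_eq hab]
  unfold lagrangian
  rw [intervalIntegral.integral_add
      (((hu.intervalIntegrable_sq hab).const_mul _).sub (hu.intervalIntegrable_potential hab hg))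
      (hu.intervalIntegrable_force hab hq),
    intervalIntegral.integral_sub ((hu.intervalIntegrable_sq hab).const_mul _)
      (hu.intervalIntegrable_potential hab hg), intervalIntegral.integral_const_mul]

theorem action_congr {r : ℝ → ℝ} (hab : a ≤ b) (h : EqOn q r (Icc a b)) (u : ℝ → ℝ) :
    action g q a b u = action g r a b u := by
  unfold action
  refine intervalIntegral.integral_congr fun t ht => ?_
  rw [uIcc_of_le hab] at ht
  simp only [h ht]

theorem DualNehari.IsNonnegMinimizer.hasL2Deriv (hu : IsNonnegMinimizer g q a b u) (hab : a ≤ b) :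
    HasL2Deriv a b u (deriv u) := .of_memH1 hab hu.1.1.1

theorem DualNehari.IsNonnegMinimizer.congr {r : ℝ → ℝ} (hu : IsNonnegMinimizer g q a b u) (hab : a ≤ b)
    (h : EqOn q r (Icc a b)) : IsNonnegMinimizer g r a b u :=
  ⟨hu.1, fun v hv => by rw [← action_congr hab h, ← action_congr hab h]; exact hu.2 v hv⟩

/-- A minimizer also minimizes on subintervals, for its own boundary values. -/
theorem DualNehari.IsNonnegMinimizer.action_le {α β : ℝ} (hu : IsNonnegMinimizer g q a b u)
    (hg : Continuous g) (hq : MemLp q ∞ volume) (hα : a ≤ α) (hαβ : α ≤ β) (hβ : β ≤ b)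
    (hv : HasL2Deriv α β v f) (hvα : v α = u α) (hvβ : v β = u β)
    (hv0 : ∀ t ∈ Icc α β, 0 ≤ v t) : action g q α β u ≤ action g q α β v := by
  classical
  have hab : a ≤ b := hα.trans (hαβ.trans hβ)
  have hU := hu.hasL2Deriv hab
  set w : ℝ → ℝ := fun t => if t ∈ Icc α β then v t else u t with hw
  set h : ℝ → ℝ := fun t => if t ∈ Ioo α β then f t else deriv u t with hh
  have w1 : EqOn w u (Icc a α) := by
    intro t ht
    by_cases h : t = α
    · subst h; simp [hw, hαβ, hvα]
    · have : ¬ α ≤ t := fun h' => h (le_antisymm ht.2 h')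
      simp [hw, this]
  have w3 : EqOn w u (Icc β b) := by
    intro t ht
    by_cases h : t = β
    · subst h; simp [hw, hαβ, hvβ]
    · have : ¬ t ≤ β := fun h' => h (le_antisymm h' ht.1)
      simp [hw, this]
  have w2 : EqOn w v (Icc α β) := fun t ht => by simp only [hw, if_pos ht]
  have d1 : HasL2Deriv a α w h := (hU.mono le_rfl (hαβ.trans hβ)).congr w1 fun t ht => by
    have : ¬ (α < t ∧ t < β) := fun h => absurd h.1 ht.2.not_gt
    simp [hh, this]
  have d2 : HasL2Deriv α β w h := hv.congr w2 fun t ht => by simp only [hh, if_pos ht]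
  have d3 : HasL2Deriv β b w h := (hU.mono (hα.trans hαβ) le_rfl).congr w3 fun t ht => by
    have : ¬ (α < t ∧ t < β) := fun h => absurd h.2 ht.1.not_gt
    simp [hh, this]
  have d := (d1.concat hα hαβ d2).concat (hα.trans hαβ) hβ d3
  have hmem : w ∈ H10plus a b := by
    refine ⟨⟨d.memH1 hab, ?_, ?_⟩, fun t ht => ?_⟩
    · rw [w1 ⟨le_rfl, hα⟩]; exact hu.1.1.2.1
    · rw [w3 ⟨hβ, le_rfl⟩]; exact hu.1.1.2.2
    · by_cases h : t ∈ Icc α β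
      · rw [w2 h]; exact hv0 t h
      · simp only [hw, if_neg h]; exact hu.1.2 t ht
  have split : ∀ {y k : ℝ → ℝ}, HasL2Deriv a b y k → action g q a b y =
      action g q a α y + action g q α β y + action g q β b y := by
    intro y k hy
    have y1 := hy.mono le_rfl (hαβ.trans hβ)
    have y2 := hy.mono hα hβ
    have y3 := hy.mono (hα.trans hαβ) le_rfl
    have i1 := y1.intervalIntegrable_lagrangian hα hg hq
    have i2 := y2.intervalIntegrable_lagrangian hαβ hg hq
    have i3 := y3.intervalIntegrable_lagrangian hβ hg hq
    rw [hy.action_eq hab, y1.action_eq hα, y2.action_eq hαβ, y3.action_eq hβ,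
      intervalIntegral.integral_add_adjacent_intervals i1 i2,
      intervalIntegral.integral_add_adjacent_intervals (i1.trans i2) i3]
  -- Functions equal on a closed interval share an `L²` derivative there, so their actions agree
  -- even if the pointwise derivatives differ at the ends.
  have eqv : ∀ {c e : ℝ} {y z k l : ℝ → ℝ}, c ≤ e → HasL2Deriv c e y k → HasL2Deriv c e z l →
      EqOn y z (Icc c e) → action g q c e y = action g q c e z := by
    intro c e y z k l hce hy hz hyz
    have hy' : HasL2Deriv c e y l := hz.congr hyz fun _ _ => rfl
    rw [hy'.action_eq hce, hz.action_eq hce]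
    refine intervalIntegral.integral_congr fun t ht => ?_
    rw [uIcc_of_le hce] at ht
    simp only [lagrangian, hyz ht]
  have key := hu.2 w hmem
  rw [split hU, split d, eqv hα d1 (hU.mono le_rfl (hαβ.trans hβ)) w1, eqv hαβ d2 hv w2,
    eqv hβ d3 (hU.mono (hα.trans hαβ) le_rfl) w3] at key
  linarith

end action

/-! ### Tent functions -/

/-- The piecewise linear function with values `0, 1, 0` at `s, m, e`. -/
noncomputable def tent (s m e t : ℝ) : ℝ := min ((t - s) / (m - s)) ((e - t) / (e - m))

/-- The derivative of `tent`. -/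
noncomputable def tentDeriv (s m e t : ℝ) : ℝ := if t ≤ m then 1 / (m - s) else -(1 / (e - m))

section tent

variable {s m e : ℝ}

theorem tent_of_le (hsm : s < m) (hme : m < e) {t : ℝ} (ht : t ≤ m) :
    tent s m e t = (t - s) / (m - s) := by
  refine min_eq_left (le_trans (b := 1) ?_ ?_)
  · rw [div_le_one (by linarith)]; linarith
  · rw [one_le_div (by linarith)]; linarith

theorem tent_of_ge (hsm : s < m) (hme : m < e) {t : ℝ} (ht : m ≤ t) :
    tent s m e t = (e - t) / (e - m) := by
  refine min_eq_right (le_trans (b := 1) ?_ ?_)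
  · rw [div_le_one (by linarith)]; linarith
  · rw [one_le_div (by linarith)]; linarith

theorem tent_nonneg (hsm : s < m) (hme : m < e) {t : ℝ} (ht : t ∈ Icc s e) :
    0 ≤ tent s m e t :=
  le_min (div_nonneg (by linarith [ht.1]) (by linarith))
    (div_nonneg (by linarith [ht.2]) (by linarith))

theorem tent_le_one (hsm : s < m) (hme : m < e) (t : ℝ) : tent s m e t ≤ 1 := by
  rcases le_total t m with ht | ht
  · rw [tent_of_le hsm hme ht, div_le_one (by linarith)]; linarith
  · rw [tent_of_ge hsm hme ht, div_le_one (by linarith)]; linarith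

theorem tent_left (hsm : s < m) (hme : m < e) : tent s m e s = 0 := by
  simp [tent_of_le hsm hme hsm.le]

theorem tent_right (hsm : s < m) (hme : m < e) : tent s m e e = 0 := by
  simp [tent_of_ge hsm hme hme.le]

theorem hasL2Deriv_tent (hsm : s < m) (hme : m < e) :
    HasL2Deriv s e (tent s m e) (tentDeriv s m e) := by
  refine HasL2Deriv.concat (c := m) hsm.le hme.le ?_ ?_
  · refine (HasL2Deriv.of_hasDerivAt (u := fun t => (t - s) / (m - s))
      (f := fun _ => 1 / (m - s)) (by fun_prop) (by fun_prop) fun t _ => ?_).congr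
      (fun t ht => tent_of_le hsm hme ht.2) (fun t ht => if_pos ht.2.le)
    exact ((hasDerivAt_id t).sub_const s).div_const _
  · refine (HasL2Deriv.of_hasDerivAt (u := fun t => (e - t) / (e - m))
      (f := fun _ => -(1 / (e - m))) (by fun_prop) (by fun_prop) fun t _ => ?_).congr
      (fun t ht => tent_of_ge hsm hme ht.1) (fun t ht => if_neg ht.1.not_ge)
    simpa [neg_div] using ((hasDerivAt_id t).const_sub e).div_const (e - m)

theorem integral_mul_tentDeriv (hsm : s < m) (hme : m < e) {f : ℝ → ℝ}
    (h₁ : IntervalIntegrable f volume s m) (h₂ : IntervalIntegrable f volume m e) :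
    ∫ t in s..e, f t * tentDeriv s m e t =
      (∫ t in s..m, f t) / (m - s) - (∫ t in m..e, f t) / (e - m) := by
  have c1 : EqOn (fun t => f t * (1 / (m - s))) (fun t => f t * tentDeriv s m e t) (uIoc s m) := by
    intro t ht
    rw [uIoc_of_le hsm.le] at ht
    simp only [tentDeriv, if_pos ht.2]
  have c2 : EqOn (fun t => f t * (-(1 / (e - m)))) (fun t => f t * tentDeriv s m e t)
      (uIoc m e) := by
    intro t ht
    rw [uIoc_of_le hme.le] at ht
    simp only [tentDeriv, if_neg ht.1.not_ge]
  rw [← intervalIntegral.integral_add_adjacent_intervals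
      ((h₁.mul_const (1 / (m - s))).congr c1) ((h₂.mul_const (-(1 / (e - m)))).congr c2),
    ← intervalIntegral.integral_congr_ae (ae_of_all _ fun t ht => c1 ht),
    ← intervalIntegral.integral_congr_ae (ae_of_all _ fun t ht => c2 ht),
    intervalIntegral.integral_mul_const, intervalIntegral.integral_mul_const]
  ring

theorem integral_tentDeriv_sq (hsm : s < m) (hme : m < e) :
    ∫ t in s..e, tentDeriv s m e t ^ 2 = 1 / (m - s) + 1 / (e - m) := by
  have hi := (hasL2Deriv_tent hsm hme)
  have hms : s ∈ Icc s e := ⟨le_rfl, (hsm.trans hme).le⟩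
  have hmm : m ∈ Icc s e := ⟨hsm.le, hme.le⟩
  have hme' : e ∈ Icc s e := ⟨(hsm.trans hme).le, le_rfl⟩
  have h1 := hi.intervalIntegrable hms hmm
  have h2 := hi.intervalIntegrable hmm hme'
  have hm1 : tent s m e m = 1 := by
    rw [tent_of_le hsm hme le_rfl, div_self (by linarith)]
  simp_rw [sq]
  rw [integral_mul_tentDeriv hsm hme h1 h2, ← hi.sub_eq hms hmm, ← hi.sub_eq hmm hme',
    tent_left hsm hme, tent_right hsm hme, hm1]
  ring

end tent

/-! ### First variation and regularity of minimizers -/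

section variation

variable {g q u : ℝ → ℝ} {a b : ℝ}

/-- The first variation of the action at `u` in the direction of a tent. -/
noncomputable def tentVariation (g q u : ℝ → ℝ) (s m e : ℝ) : ℝ :=
  (u m - u s) / (m - s) - (u e - u m) / (e - m) + ∫ t in s..e, (q t - g (u t)) * tent s m e t

/-- Convexity of the potential puts `G(u + τ T)` above its linearization at `u`, for `τ` of either
sign. Hence the only second-order term is the kinetic one, and no Taylor remainder of `g` has to be
estimated. -/
theorem DualNehari.IsNonnegMinimizer.tentVariation_ge (hu : IsNonnegMinimizer g q a b u)
    (hg : Continuous g) (hm : Monotone g) (hq : MemLp q ∞ volume) {s m e : ℝ} (hs : a ≤ s)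
    (hsm : s < m) (hme : m < e) (he : e ≤ b) {τ : ℝ}
    (hpos : ∀ t ∈ Icc s e, 0 ≤ u t + τ * tent s m e t) :
    0 ≤ τ * tentVariation g q u s m e + τ ^ 2 / 2 * (1 / (m - s) + 1 / (e - m)) := by
  have hse : s ≤ e := (hsm.trans hme).le
  have hab : a ≤ b := hs.trans (hse.trans he)
  have hU := (hu.hasL2Deriv hab).mono hs he
  have hT := hasL2Deriv_tent hsm hme
  have hV := hU.add (hT.const_mul τ)
  have key := hu.action_le hg hq hs hse he hV (by simp [tent_left hsm hme])
    (by simp [tent_right hsm hme]) hpos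
  rw [hU.action_eq hse, hV.action_eq hse] at key
  have I1 := hU.intervalIntegrable_lagrangian hse hg hq
  have I2 := hU.intervalIntegrable_mul hse hT
  have I3 := hT.intervalIntegrable_sq hse
  have I4 : IntervalIntegrable (fun t => (q t - g (u t)) * tent s m e t) volume s e := by
    refine IntervalIntegrable.mul_continuousOn ((intervalIntegrable_of_memLp_top hq s e).sub
      (ContinuousOn.intervalIntegrable ?_)) ?_
    · rw [uIcc_of_le hse]; exact hg.comp_continuousOn hU.continuousOn
    · rw [uIcc_of_le hse]; exact hT.continuousOn
  have le : ∫ t in s..e, lagrangian g q (fun t => u t + τ * tent s m e t)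
        (fun t => deriv u t + τ * tentDeriv s m e t) t ≤
      ∫ t in s..e, (lagrangian g q u (deriv u) t + τ * (deriv u t * tentDeriv s m e t) +
        τ ^ 2 / 2 * tentDeriv s m e t ^ 2 + τ * ((q t - g (u t)) * tent s m e t)) := by
    refine intervalIntegral.integral_mono_on hse (hV.intervalIntegrable_lagrangian hse hg hq)
      (((I1.add (I2.const_mul _)).add (I3.const_mul _)).add (I4.const_mul _)) fun t _ => ?_
    have := potential_add_mul_le hg hm (u t) (u t + τ * tent s m e t)
    simp only [lagrangian]
    nlinarith
  rw [intervalIntegral.integral_add ((I1.add (I2.const_mul _)).add (I3.const_mul _))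
      (I4.const_mul _), intervalIntegral.integral_add (I1.add (I2.const_mul _)) (I3.const_mul _),
    intervalIntegral.integral_add I1 (I2.const_mul _), intervalIntegral.integral_const_mul,
    intervalIntegral.integral_const_mul, intervalIntegral.integral_const_mul,
    integral_tentDeriv_sq hsm hme,
    integral_mul_tentDeriv hsm hme
      (hU.intervalIntegrable ⟨le_rfl, hse⟩ ⟨hsm.le, hme.le⟩)
      (hU.intervalIntegrable ⟨hsm.le, hme.le⟩ ⟨hse, le_rfl⟩),
    ← hU.sub_eq ⟨le_rfl, hse⟩ ⟨hsm.le, hme.le⟩, ← hU.sub_eq ⟨hsm.le, hme.le⟩ ⟨hse, le_rfl⟩] at le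
  unfold tentVariation
  linarith

theorem nonneg_of_forall_small {x c r : ℝ} (hr : 0 < r)
    (h : ∀ τ ∈ Ioo 0 r, 0 ≤ τ * x + τ ^ 2 / 2 * c) : 0 ≤ x := by
  have hlim : Tendsto (fun τ : ℝ => x + τ / 2 * c) (𝓝[>] 0) (𝓝 (x + 0 / 2 * c)) :=
    (Continuous.tendsto (by fun_prop) 0).mono_left nhdsWithin_le_nhds
  have : 0 ≤ x + 0 / 2 * c := by
    refine ge_of_tendsto hlim ?_
    filter_upwards [Ioo_mem_nhdsGT hr] with τ hτ
    have := h τ hτ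
    have h2 : 0 ≤ τ * (x + τ / 2 * c) := by linarith
    exact nonneg_of_mul_nonneg_right h2 hτ.1
  simpa using this

/-- A nonnegative minimizer grows at most quadratically away from an interior zero. -/
theorem DualNehari.IsNonnegMinimizer.le_of_zero (hu : IsNonnegMinimizer g q a b u)
    (hg : Continuous g) (hm : Monotone g) (hq : MemLp q ∞ volume) {K : ℝ}
    (hK : ∀ᵐ t, ∀ x, q t - g x ≤ K) {s m e : ℝ} (hs : a ≤ s)
    (hsm : s < m) (hme : m < e) (he : e ≤ b) (h0 : u m = 0) :
    u s / (m - s) + u e / (e - m) ≤ |K| * (e - s) := by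
  have hse : s ≤ e := (hsm.trans hme).le
  have hab : a ≤ b := hs.trans (hse.trans he)
  have hU := (hu.hasL2Deriv hab).mono hs he
  have hT := hasL2Deriv_tent hsm hme
  -- At a zero of `u` only an upward push is guaranteed to be admissible, so the variation is known
  -- to be nonnegative and no more. Its slope part is `-(u s/(m-s) + u e/(e-m))`, which the integral
  -- must therefore dominate.
  have h := nonneg_of_forall_small one_pos fun τ hτ =>
    hu.tentVariation_ge hg hm hq hs hsm hme he (τ := τ) fun t ht =>
      add_nonneg (hu.1.2 t ⟨hs.trans ht.1, ht.2.trans he⟩)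
        (mul_nonneg hτ.1.le (tent_nonneg hsm hme ht))
  have I4 : IntervalIntegrable (fun t => (q t - g (u t)) * tent s m e t) volume s e := by
    refine IntervalIntegrable.mul_continuousOn ((intervalIntegrable_of_memLp_top hq s e).sub
      (ContinuousOn.intervalIntegrable ?_)) ?_
    · rw [uIcc_of_le hse]; exact hg.comp_continuousOn hU.continuousOn
    · rw [uIcc_of_le hse]; exact hT.continuousOn
  have hint : ∫ t in s..e, (q t - g (u t)) * tent s m e t ≤ ∫ t in s..e, |K| := by
    refine intervalIntegral.integral_mono_ae_restrict hse I4 intervalIntegrable_const ?_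
    filter_upwards [ae_restrict_of_ae hK, ae_restrict_mem measurableSet_Icc] with t ht hts
    have h1 := tent_nonneg hsm hme hts
    have h2 := tent_le_one hsm hme t
    calc (q t - g (u t)) * tent s m e t ≤ |K| * tent s m e t :=
          mul_le_mul_of_nonneg_right ((ht _).trans (le_abs_self K)) h1
      _ ≤ |K| := mul_le_of_le_one_right (abs_nonneg K) h2
  rw [intervalIntegral.integral_const, smul_eq_mul] at hint
  unfold tentVariation at h
  rw [h0, zero_sub, sub_zero, neg_div] at h
  linarith

theorem DualNehari.IsNonnegMinimizer.tentVariation_eq_zero (hu : IsNonnegMinimizer g q a b u)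
    (hg : Continuous g) (hm : Monotone g) (hq : MemLp q ∞ volume)
    (hpos : ∀ t ∈ Ioo a b, 0 < u t) {s m e : ℝ} (hs : a < s)
    (hsm : s < m) (hme : m < e) (he : e < b) : tentVariation g q u s m e = 0 := by
  have hse : s ≤ e := (hsm.trans hme).le
  have hab : a ≤ b := hs.le.trans (hse.trans he.le)
  have hU := (hu.hasL2Deriv hab).mono hs.le he.le
  -- The minimum of `u` over the support is positive, so tents of height below it may be added or
  -- subtracted, and the variation vanishes.
  obtain ⟨t₀, ht₀, hmin⟩ := isCompact_Icc.exists_isMinOn (nonempty_Icc.2 hse) hU.continuousOn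
  have hr : 0 < u t₀ := hpos t₀ ⟨hs.trans_le ht₀.1, ht₀.2.trans_lt he⟩
  have key : ∀ τ : ℝ, |τ| < u t₀ →
      0 ≤ τ * tentVariation g q u s m e + τ ^ 2 / 2 * (1 / (m - s) + 1 / (e - m)) := by
    intro τ hτ
    refine hu.tentVariation_ge hg hm hq hs.le hsm hme he.le fun t ht => ?_
    have h1 := tent_nonneg hsm hme ht
    have h2 := tent_le_one hsm hme t
    have h3 : |τ * tent s m e t| ≤ |τ| := by
      rw [abs_mul, abs_of_nonneg h1]
      exact mul_le_of_le_one_right (abs_nonneg τ) h2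
    have h4 : u t₀ ≤ u t := hmin ht
    have h5 := neg_abs_le (τ * tent s m e t)
    linarith
  refine le_antisymm ?_ ?_
  · have : 0 ≤ -tentVariation g q u s m e := nonneg_of_forall_small
        (c := 1 / (m - s) + 1 / (e - m)) hr fun τ hτ => by
      have := key (-τ) (by rw [abs_neg, abs_of_pos hτ.1]; exact hτ.2)
      rw [neg_mul, neg_sq] at this
      linarith
    linarith
  · exact nonneg_of_forall_small hr fun τ hτ => key τ (by rw [abs_of_pos hτ.1]; exact hτ.2)

/-- A function on `[a,b]` satisfying the three point identity in `(a,b)` is affine. -/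
theorem eq_affine_of_slopes {Φ : ℝ → ℝ} (hΦ : ContinuousOn Φ (Icc a b)) (hab : a < b)
    (h : ∀ s m e, a < s → s < m → m < e → e < b →
      (Φ m - Φ s) / (m - s) = (Φ e - Φ m) / (e - m)) :
    ∀ m ∈ Icc a b, Φ m = Φ a + (Φ b - Φ a) / (b - a) * (m - a) := by
  have hba : b - a ≠ 0 := by linarith
  intro m hm
  rcases eq_or_lt_of_le hm.1 with rfl | ham
  · simp
  rcases eq_or_lt_of_le hm.2 with rfl | hmb
  · field_simp
    ring
  -- The identity is available only at interior points; moving the outer points to `a` and `b`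
  -- carries it to the closed interval by continuity.
  have la : Tendsto (fun l : ℝ => Φ (a + l)) (𝓝[>] 0) (𝓝 (Φ a)) := by
    refine (hΦ a (left_mem_Icc.2 hab.le)).tendsto.comp (tendsto_nhdsWithin_iff.2 ⟨?_, ?_⟩)
    · exact ((Continuous.tendsto' (by fun_prop) 0 a (by simp)).mono_left nhdsWithin_le_nhds)
    · filter_upwards [Ioo_mem_nhdsGT (sub_pos.2 hab)] with l hl
      exact ⟨by linarith [hl.1], by linarith [hl.2]⟩
  have lb : Tendsto (fun l : ℝ => Φ (b - l)) (𝓝[>] 0) (𝓝 (Φ b)) := by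
    refine (hΦ b (right_mem_Icc.2 hab.le)).tendsto.comp (tendsto_nhdsWithin_iff.2 ⟨?_, ?_⟩)
    · exact ((Continuous.tendsto' (by fun_prop) 0 b (by simp)).mono_left nhdsWithin_le_nhds)
    · filter_upwards [Ioo_mem_nhdsGT (sub_pos.2 hab)] with l hl
      exact ⟨by linarith [hl.2], by linarith [hl.1]⟩
  have l1 : Tendsto (fun l : ℝ => (b - l) - m) (𝓝[>] 0) (𝓝 (b - m)) :=
    (Continuous.tendsto' (by fun_prop) 0 _ (by simp)).mono_left nhdsWithin_le_nhds
  have l2 : Tendsto (fun l : ℝ => m - (a + l)) (𝓝[>] 0) (𝓝 (m - a)) :=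
    (Continuous.tendsto' (by fun_prop) 0 _ (by simp)).mono_left nhdsWithin_le_nhds
  have key : (Φ m - Φ a) * (b - m) = (Φ b - Φ m) * (m - a) := by
    refine tendsto_nhds_unique ((tendsto_const_nhds.sub la).mul l1)
      (((lb.sub tendsto_const_nhds).mul l2).congr' ?_)
    filter_upwards [Ioo_mem_nhdsGT (sub_pos.2 ham), Ioo_mem_nhdsGT (sub_pos.2 hmb)] with l h1 h2
    have := h (a + l) m (b - l) (by linarith [h1.1]) (by linarith [h1.2]) (by linarith [h2.2])
      (by linarith [h2.1])
    rw [div_eq_div_iff (by linarith [h1.2]) (by linarith [h2.2])] at this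
    exact this.symm
  field_simp
  linarith

/-- A positive minimizer is, up to the boundary, a classical solution of `ü + g(u) = q`. -/
theorem DualNehari.IsNonnegMinimizer.exists_classical (hu : IsNonnegMinimizer g q a b u)
    (hg : Continuous g) (hm : Monotone g) (hq : MemLp q ∞ volume) (hqc : Continuous q)
    (hab : a < b) (hpos : ∀ t ∈ Ioo a b, 0 < u t) :
    ∃ U U' : ℝ → ℝ, EqOn U u (Icc a b) ∧ (∀ t, HasDerivAt U (U' t) t) ∧
      ∀ t ∈ Icc a b, HasDerivAt U' (q t - g (U t)) t := by
  have hU := hu.hasL2Deriv hab.le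
  -- Extending `u` continuously makes the right-hand side continuous on the line, so that its
  -- primitives are differentiable at the endpoints as well.
  set E : ℝ → ℝ := IccExtend hab.le ((Icc a b).domRestrict u) with hE
  have hEc : Continuous E := (continuousOn_iff_continuous_domRestrict.1 hU.continuousOn).Icc_extend'
  have hEu : EqOn E u (Icc a b) := fun t ht => by
    simp [hE, IccExtend_of_mem _ _ ht, Set.domRestrict_apply]
  set F : ℝ → ℝ := fun t => q t - g (E t) with hF
  have hFc : Continuous F := hqc.sub (hg.comp hEc)
  set Y : ℝ → ℝ := fun t => ∫ s in a..t, F s with hY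
  have hYd : ∀ t, HasDerivAt Y (F t) t := fun t => intervalIntegral.integral_hasDerivAt_right
    (hFc.intervalIntegrable _ _) (hFc.stronglyMeasurableAtFilter _ _) hFc.continuousAt
  have hYc : Continuous Y := continuous_iff_continuousAt.2 fun t => (hYd t).continuousAt
  set Z : ℝ → ℝ := fun t => ∫ s in a..t, Y s with hZ
  have hZd : ∀ t, HasDerivAt Z (Y t) t := fun t => intervalIntegral.integral_hasDerivAt_right
    (hYc.intervalIntegrable _ _) (hYc.stronglyMeasurableAtFilter _ _) hYc.continuousAt
  have hZc : Continuous Z := continuous_iff_continuousAt.2 fun t => (hZd t).continuousAt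
  -- With `Z̈ = F`, integrating the force term by parts against the tent turns the vanishing
  -- variation of `u` into the three point identity for `u - Z`. This plays the role of the
  -- fundamental lemma of the calculus of variations.
  have slopes : ∀ s m e, a < s → s < m → m < e → e < b →
      ((u m - Z m) - (u s - Z s)) / (m - s) = ((u e - Z e) - (u m - Z m)) / (e - m) := by
    intro s m e hs hsm hme he
    have hse : s ≤ e := (hsm.trans hme).le
    have h0 := hu.tentVariation_eq_zero hg hm hq hpos hs hsm hme he
    have hT := hasL2Deriv_tent hsm hme
    have hYL : HasL2Deriv s e Y F :=
      .of_hasDerivAt hYc.continuousOn hFc.continuousOn fun t _ => hYd t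
    have hZL : HasL2Deriv s e Z Y :=
      .of_hasDerivAt hZc.continuousOn hYc.continuousOn fun t _ => hZd t
    have h1 := hYL.integral_mul_eq hse hT
    have ms : s ∈ Icc s e := ⟨le_rfl, hse⟩
    have mm : m ∈ Icc s e := ⟨hsm.le, hme.le⟩
    have me : e ∈ Icc s e := ⟨hse, le_rfl⟩
    rw [integral_mul_tentDeriv hsm hme (hZL.intervalIntegrable ms mm)
      (hZL.intervalIntegrable mm me), ← hZL.sub_eq ms mm, ← hZL.sub_eq mm me,
      tent_left hsm hme, tent_right hsm hme] at h1
    have h2 : ∫ t in s..e, F t * tent s m e t =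
        ∫ t in s..e, (q t - g (u t)) * tent s m e t := by
      refine intervalIntegral.integral_congr fun t ht => ?_
      rw [uIcc_of_le hse] at ht
      simp only [hF, hEu ⟨hs.le.trans ht.1, ht.2.trans he.le⟩]
    unfold tentVariation at h0
    rw [h2] at h1
    have e1 : ((u m - Z m) - (u s - Z s)) / (m - s) =
      (u m - u s) / (m - s) - (Z m - Z s) / (m - s) := by ring
    have e2 : ((u e - Z e) - (u m - Z m)) / (e - m) =
      (u e - u m) / (e - m) - (Z e - Z m) / (e - m) := by ring
    rw [e1, e2]
    linarith
  have aff := eq_affine_of_slopes (Φ := fun t => u t - Z t)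
    (hU.continuousOn.sub hZc.continuousOn) hab slopes
  set c := ((u b - Z b) - (u a - Z a)) / (b - a)
  refine ⟨fun t => Z t + ((u a - Z a) + c * (t - a)), fun t => Y t + c, ?_, ?_, ?_⟩
  · intro t ht
    have := aff t ht
    linarith
  · intro t
    have := (((hasDerivAt_id t).sub_const a).const_mul c).const_add (u a - Z a)
    rw [mul_one] at this
    exact (hZd t).add this
  · intro t ht
    have h1 : Z t + ((u a - Z a) + c * (t - a)) = E t := by
      rw [hEu ht]
      have := aff t ht
      linarith
    change HasDerivAt (fun t => Y t + c) (q t - g (Z t + ((u a - Z a) + c * (t - a)))) t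
    rw [h1]
    exact (hYd t).add_const c

end variation

/-! ### Coercivity and existence of minimizers -/

section existence

variable {g q u f : ℝ → ℝ} {a b C Q K : ℝ}

theorem ae_abs_le_eLpNorm {q : ℝ → ℝ} (hq : MemLp q ∞ volume) :
    ∀ᵐ t, |q t| ≤ (eLpNorm q ∞ volume).toReal := by
  filter_upwards [ae_le_eLpNormEssSup (f := q) (μ := volume)] with t ht
  rw [← eLpNorm_exponent_top] at ht
  have := ENNReal.toReal_mono hq.2.ne ht
  simpa using this

theorem HasL2Deriv.abs_lower_order_le (hu : HasL2Deriv a b u f) (hab : a ≤ b) (hg : Continuous g)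
    (hC : ∀ s, |g s| ≤ C) (hq : MemLp q ∞ volume) (hQ : ∀ᵐ t, |q t| ≤ Q) {B : ℝ}
    (hB : ∀ t ∈ Icc a b, |u t| ≤ B) :
    |(∫ t in a..b, q t * u t) - ∫ t in a..b, potential g (u t)| ≤ (C + Q) * B * (b - a) := by
  have hC0 : 0 ≤ C := (abs_nonneg _).trans (hC 0)
  rw [← intervalIntegral.integral_sub (hu.intervalIntegrable_force hab hq)
    (hu.intervalIntegrable_potential hab hg)]
  have h := intervalIntegral.norm_integral_le_of_norm_le_const_ae (a := a) (b := b)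
    (f := fun t => q t * u t - potential g (u t)) (C := (C + Q) * B) (by
      filter_upwards [hQ] with t ht htab
      rw [uIoc_of_le hab] at htab
      have h1 := hB t (Ioc_subset_Icc_self htab)
      have h2 := abs_potential_sub_le hg hC (u t) 0
      rw [potential_zero, sub_zero, sub_zero] at h2
      calc ‖q t * u t - potential g (u t)‖ ≤ |q t| * |u t| + C * |u t| := by
            rw [Real.norm_eq_abs]
            refine (abs_sub _ _).trans ?_
            rw [abs_mul]
            linarith
        _ ≤ Q * B + C * B := by
            have := mul_le_mul ht h1 (abs_nonneg _) ((abs_nonneg _).trans ht)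
            have := mul_le_mul_of_nonneg_left h1 hC0
            linarith
        _ = (C + Q) * B := by ring)
  rwa [abs_of_nonneg (sub_nonneg.2 hab), Real.norm_eq_abs] at h

/-- Coercivity of the action. -/
theorem HasL2Deriv.integral_sq_le (hu : HasL2Deriv a b u f) (hab : a < b) (hg : Continuous g)
    (hC : ∀ s, |g s| ≤ C) (hq : MemLp q ∞ volume) (hQ : ∀ᵐ t, |q t| ≤ Q) (hK : 0 < K)
    (hCQ : C + Q ≤ K) (ha : u a = 0) :
    ∫ t in a..b, f t ^ 2 ≤ 4 * (action g q a b u + K ^ 2 * (b - a) ^ 3) := by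
  have hl : 0 < b - a := sub_pos.2 hab
  -- With this weight the lower-order terms absorb exactly `D/4` of the kinetic term `D/2`.
  have h1 := hu.integral_abs_le hab.le (c := 2 * K * (b - a)) (by positivity)
  have h0 : 0 ≤ ∫ t in a..b, |f t| :=
    intervalIntegral.integral_nonneg hab.le fun t _ => abs_nonneg _
  have h2 := hu.abs_lower_order_le hab.le hg hC hq hQ (fun t ht => hu.abs_le ha ht)
  have h3 : (C + Q) * (∫ t in a..b, |f t|) * (b - a) ≤ K * (∫ t in a..b, |f t|) * (b - a) := by
    gcongr
  rw [hu.action_eq_add hab.le hg hq]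
  set D := ∫ t in a..b, f t ^ 2
  have h4 : K * (∫ t in a..b, |f t|) * (b - a) ≤
      K * ((2 * K * (b - a) * (b - a) + D / (2 * K * (b - a))) / 2) * (b - a) := by
    gcongr
  have h5 : K * ((2 * K * (b - a) * (b - a) + D / (2 * K * (b - a))) / 2) * (b - a) =
      K ^ 2 * (b - a) ^ 3 + D / 4 := by
    field_simp
    ring
  have h6 := neg_abs_le ((∫ t in a..b, q t * u t) - ∫ t in a..b, potential g (u t))
  linarith

theorem zero_mem_H10plus (hab : a ≤ b) : (fun _ => (0 : ℝ)) ∈ H10plus a b :=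
  ⟨⟨(HasL2Deriv.of_hasDerivAt (f := fun _ => 0) continuousOn_const continuousOn_const
    fun t _ => hasDerivAt_const t 0).memH1 hab, rfl, rfl⟩, fun _ _ => le_rfl⟩

theorem action_zero (g q : ℝ → ℝ) (a b : ℝ) : action g q a b (fun _ => 0) = 0 := by
  simp [action]

/-- Evaluating a primitive at `t` is a continuous linear functional of the derivative, so weak
convergence of derivatives gives pointwise convergence of the functions. -/
theorem inner_indicatorConstLp_Ioc {F : Lp ℝ 2 (volume.restrict (Ioc a b))} {f : ℝ → ℝ}
    (hF : F =ᵐ[volume.restrict (Ioc a b)] f) {t : ℝ} (ht : t ∈ Icc a b) :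
    inner ℝ (indicatorConstLp 2 (μ := volume.restrict (Ioc a b)) (s := Ioc a t) measurableSet_Ioc
      (measure_ne_top _ _) (1 : ℝ)) F = ∫ s in a..t, f s := by
  rw [L2.inner_indicatorConstLp_one, Measure.restrict_restrict measurableSet_Ioc,
    inter_eq_left.2 (Ioc_subset_Ioc_right ht.2), intervalIntegral.integral_of_le ht.1]
  exact integral_congr_ae (ae_mono (Measure.restrict_mono (Ioc_subset_Ioc_right ht.2) le_rfl) hF)

theorem norm_sq_eq_integral {F : Lp ℝ 2 (volume.restrict (Ioc a b))} {f : ℝ → ℝ}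
    (hab : a ≤ b) (hF : F =ᵐ[volume.restrict (Ioc a b)] f) :
    ‖F‖ ^ 2 = ∫ s in a..b, f s ^ 2 := by
  rw [← real_inner_self_eq_norm_sq, L2.inner_def, intervalIntegral.integral_of_le hab]
  refine integral_congr_ae ?_
  filter_upwards [hF] with t ht
  simp [ht, sq]

/-- Bounded sequences in a separable Hilbert space have weakly convergent subsequences. -/
theorem exists_weak_limit {X : Type*} [NormedAddCommGroup X] [InnerProductSpace ℝ X]
    [CompleteSpace X] [TopologicalSpace.SeparableSpace X] {F : ℕ → X} {R : ℝ}
    (hF : ∀ n, ‖F n‖ ≤ R) :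
    ∃ (L : X) (φ : ℕ → ℕ), StrictMono φ ∧
      ∀ y, Tendsto (fun n => inner ℝ (F (φ n)) y) atTop (𝓝 (inner ℝ L y)) := by
  have hc := WeakDual.isSeqCompact_closedBall ℝ X (0 : StrongDual ℝ X) R
  obtain ⟨x, -, φ, hφ, hx⟩ := hc (x := fun n =>
      StrongDual.toWeakDual (InnerProductSpace.toDual ℝ X (F n))) (fun n => by
    simpa using hF n)
  refine ⟨(InnerProductSpace.toDual ℝ X).symm (WeakDual.toStrongDual x), φ, hφ, fun y => ?_⟩
  have h1 := (WeakDual.eval_continuous (𝕜 := ℝ) y).tendsto x |>.comp hx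
  rw [InnerProductSpace.toDual_symm_apply]
  exact h1

/-- Existence of nonnegative minimizers. -/
theorem exists_isNonnegMinimizer (hg : Continuous g) (hC : ∀ s, |g s| ≤ C)
    (hq : MemLp q ∞ volume) (hab : a < b) : ∃ u, IsNonnegMinimizer g q a b u := by
  have hQ := ae_abs_le_eLpNorm hq
  set Q := (eLpNorm q ∞ volume).toReal
  have hQ0 : 0 ≤ Q := ENNReal.toReal_nonneg
  have hC0 : 0 ≤ C := (abs_nonneg _).trans (hC 0)
  have hK : 0 < C + Q + 1 := by linarith
  set K := C + Q + 1 with hKdef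
  have coercive : ∀ {v k : ℝ → ℝ}, HasL2Deriv a b v k → v a = 0 →
      ∫ t in a..b, k t ^ 2 ≤ 4 * (action g q a b v + K ^ 2 * (b - a) ^ 3) := fun hv h0 =>
    hv.integral_sq_le hab hg hC hq hQ hK (by linarith) h0
  have hne : (action g q a b '' H10plus a b).Nonempty := ⟨_, _, zero_mem_H10plus hab.le, rfl⟩
  have hbdd : BddBelow (action g q a b '' H10plus a b) := by
    refine ⟨-(K ^ 2 * (b - a) ^ 3), ?_⟩
    rintro _ ⟨v, hv, rfl⟩
    have h1 := coercive (HasL2Deriv.of_memH1 hab.le hv.1.1) hv.1.2.1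
    have h2 : 0 ≤ ∫ t in a..b, deriv v t ^ 2 :=
      intervalIntegral.integral_nonneg hab.le fun t _ => sq_nonneg _
    linarith
  obtain ⟨J, hJanti, hJlim, hJmem⟩ := exists_seq_tendsto_sInf hne hbdd
  choose v hv hvJ using hJmem
  have hL : ∀ n, HasL2Deriv a b (v n) (deriv (v n)) := fun n => .of_memH1 hab.le (hv n).1.1
  have hmem : ∀ n, MemLp (deriv (v n)) 2 (volume.restrict (Ioc a b)) := fun n => by
    rw [← restrict_Ioo_eq_restrict_Ioc]; exact (hL n).memLp
  set F : ℕ → Lp ℝ 2 (volume.restrict (Ioc a b)) := fun n => (hmem n).toLp with hF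
  have hFae : ∀ n, F n =ᵐ[volume.restrict (Ioc a b)] deriv (v n) := fun n => (hmem n).coeFn_toLp
  -- The minimizing values decrease, so the first of them bounds every energy through coercivity.
  set D := 4 * (J 0 + K ^ 2 * (b - a) ^ 3)
  have hD : ∀ n, ∫ t in a..b, deriv (v n) t ^ 2 ≤ D := fun n => by
    have h1 := coercive (hL n) (hv n).1.2.1
    have h2 := hJanti (Nat.zero_le n)
    rw [hvJ n] at h1
    linarith
  -- Needed for the separability of `L²`.
  have : Fact ((2 : ℝ≥0∞) ≠ ∞) := ⟨by norm_num⟩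
  obtain ⟨L, φ, hφ, hweak⟩ := exists_weak_limit (F := F) (R := √D) fun n => by
    refine Real.le_sqrt_of_sq_le ?_
    rw [norm_sq_eq_integral hab.le (hFae n)]
    exact hD n
  set u : ℝ → ℝ := fun t => ∫ s in a..t, L s with hu
  have hua : u a = 0 := by simp [hu]
  have hLu : HasL2Deriv a b u L := by
    refine ⟨?_, fun t _ => by rw [hua, zero_add]⟩
    rw [restrict_Ioo_eq_restrict_Ioc]
    exact Lp.memLp L
  have hpt : ∀ t ∈ Icc a b, Tendsto (fun n => v (φ n) t) atTop (𝓝 (u t)) := by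
    intro t ht
    have h1 := hweak (indicatorConstLp 2 (μ := volume.restrict (Ioc a b)) (s := Ioc a t)
      measurableSet_Ioc (measure_ne_top _ _) (1 : ℝ))
    rw [real_inner_comm, inner_indicatorConstLp_Ioc (EventuallyEq.refl _ _) ht] at h1
    refine h1.congr fun n => ?_
    rw [real_inner_comm, inner_indicatorConstLp_Ioc (hFae _) ht,
      (hL (φ n)).eq_integral t ht, (hv (φ n)).1.2.1, zero_add]
  have hu0 : ∀ t ∈ Icc a b, 0 ≤ u t := fun t ht =>
    ge_of_tendsto' (hpt t ht) fun n => (hv (φ n)).2 t ht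
  have hub : u b = 0 := tendsto_nhds_unique (hpt b (right_mem_Icc.2 hab.le))
    (tendsto_const_nhds.congr fun n => ((hv (φ n)).1.2.2).symm)
  set B := (1 * (b - a) + D / 1) / 2
  have hB : ∀ n, ∀ t ∈ Icc a b, |v n t| ≤ B := fun n t ht => by
    refine ((hL n).abs_le (hv n).1.2.1 ht).trans
      (((hL n).integral_abs_le hab.le one_pos).trans ?_)
    have := hD n
    simp only [B]
    linarith
  have limG : Tendsto (fun n => ∫ t in a..b, potential g (v (φ n) t)) atTop
      (𝓝 (∫ t in a..b, potential g (u t))) := by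
    refine intervalIntegral.tendsto_integral_filter_of_dominated_convergence (fun _ => C * B)
      (Eventually.of_forall fun n => ?_) (Eventually.of_forall fun n => ae_of_all _ fun t ht => ?_)
      intervalIntegrable_const (ae_of_all _ fun t ht => ?_)
    · rw [uIoc_of_le hab.le]
      exact ((hL (φ n)).intervalIntegrable_potential hab.le hg).1.aestronglyMeasurable
    · rw [uIoc_of_le hab.le] at ht
      have h2 := abs_potential_sub_le hg hC (v (φ n) t) 0
      rw [potential_zero, sub_zero, sub_zero] at h2
      exact h2.trans (mul_le_mul_of_nonneg_left (hB _ t (Ioc_subset_Icc_self ht)) hC0)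
    · rw [uIoc_of_le hab.le] at ht
      exact ((continuous_potential hg).tendsto _).comp (hpt t (Ioc_subset_Icc_self ht))
  have limq : Tendsto (fun n => ∫ t in a..b, q t * v (φ n) t) atTop
      (𝓝 (∫ t in a..b, q t * u t)) := by
    refine intervalIntegral.tendsto_integral_filter_of_dominated_convergence (fun t => |q t| * B)
      (Eventually.of_forall fun n => ?_) (Eventually.of_forall fun n => ae_of_all _ fun t ht => ?_)
      ((intervalIntegrable_of_memLp_top hq a b).abs.mul_const B) (ae_of_all _ fun t ht => ?_)
    · rw [uIoc_of_le hab.le]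
      exact ((hL (φ n)).intervalIntegrable_force hab.le hq).1.aestronglyMeasurable
    · rw [uIoc_of_le hab.le] at ht
      rw [Real.norm_eq_abs, abs_mul]
      exact mul_le_mul_of_nonneg_left (hB _ t (Ioc_subset_Icc_self ht)) (abs_nonneg _)
    · rw [uIoc_of_le hab.le] at ht
      exact (hpt t (Ioc_subset_Icc_self ht)).const_mul _
  have hle : action g q a b u ≤ sInf (action g q a b '' H10plus a b) := by
    -- Weak lower semicontinuity: `‖F - L‖² ≥ 0` bounds `‖F‖²/2` below by `⟨F, L⟩ - ‖L‖²/2`, which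
    -- is affine in `F` and passes to the weak limit.
    have lower : ∀ n, inner ℝ (F (φ n)) L - 1 / 2 * ‖L‖ ^ 2 -
        (∫ t in a..b, potential g (v (φ n) t)) + ∫ t in a..b, q t * v (φ n) t ≤ J (φ n) := by
      intro n
      have h1 : 0 ≤ ‖F (φ n) - L‖ ^ 2 := sq_nonneg _
      rw [norm_sub_sq_real, norm_sq_eq_integral hab.le (hFae _)] at h1
      rw [← hvJ, (hL (φ n)).action_eq_add hab.le hg hq]
      linarith
    have hlim := (((hweak L).sub_const (1 / 2 * ‖L‖ ^ 2)).sub limG).add limq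
    have h2 := le_of_tendsto_of_tendsto' hlim (hJlim.comp hφ.tendsto_atTop) lower
    rw [hLu.action_eq_add hab.le hg hq, ← norm_sq_eq_integral hab.le (EventuallyEq.refl _ (⇑L))]
    rw [real_inner_self_eq_norm_sq] at h2
    linarith
  exact ⟨u, ⟨⟨hLu.memH1 hab.le, hua, hub⟩, hu0⟩, fun w hw =>
    hle.trans (csInf_le hbdd ⟨w, hw, rfl⟩)⟩

end existence

/-! ### The limiting problem with constant force -/

section parabola

/-- The minimizer of `∫ (u̇² / 2 - κ u)` on `(α, β)` with zero boundary values. -/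
noncomputable def parabola (κ α β t : ℝ) : ℝ := κ / 2 * ((t - α) * (β - t))

/-- The derivative of `parabola`. -/
noncomputable def parabolaDeriv (κ α β t : ℝ) : ℝ := κ / 2 * (α + β - 2 * t)

variable {κ α β : ℝ} {u f : ℝ → ℝ}

theorem hasDerivAt_parabola (κ α β t : ℝ) :
    HasDerivAt (parabola κ α β) (parabolaDeriv κ α β t) t := by
  have := (((hasDerivAt_id t).sub_const α).mul ((hasDerivAt_id t).const_sub β)).const_mul (κ / 2)
  refine this.congr_deriv ?_
  simp only [parabolaDeriv, id]
  ring

theorem hasDerivAt_parabolaDeriv (κ α β t : ℝ) :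
    HasDerivAt (parabolaDeriv κ α β) (-κ) t := by
  have := (((hasDerivAt_id t).const_mul 2).const_sub (α + β)).const_mul (κ / 2)
  refine this.congr_deriv ?_
  ring

theorem continuous_parabola (κ α β : ℝ) : Continuous (parabola κ α β) := by
  unfold parabola; fun_prop

theorem continuous_parabolaDeriv (κ α β : ℝ) : Continuous (parabolaDeriv κ α β) := by
  unfold parabolaDeriv; fun_prop

theorem hasL2Deriv_parabola (κ α β : ℝ) :
    HasL2Deriv α β (parabola κ α β) (parabolaDeriv κ α β) :=
  .of_hasDerivAt (continuous_parabola κ α β).continuousOn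
    (continuous_parabolaDeriv κ α β).continuousOn fun t _ => hasDerivAt_parabola κ α β t

theorem parabola_left (κ α β : ℝ) : parabola κ α β α = 0 := by simp [parabola]

theorem parabola_right (κ α β : ℝ) : parabola κ α β β = 0 := by simp [parabola]

theorem parabola_nonneg (hκ : 0 ≤ κ) {t : ℝ} (ht : t ∈ Icc α β) : 0 ≤ parabola κ α β t :=
  mul_nonneg (by linarith) (mul_nonneg (by linarith [ht.1]) (by linarith [ht.2]))

theorem integral_parabolaDeriv_sq_le (hκ : 0 ≤ κ) (hαβ : α ≤ β) :
    ∫ t in α..β, parabolaDeriv κ α β t ^ 2 ≤ κ ^ 2 * (β - α) ^ 3 := by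
  have : ∫ t in α..β, parabolaDeriv κ α β t ^ 2 ≤ ∫ t in α..β, (κ * (β - α)) ^ 2 := by
    refine intervalIntegral.integral_mono_on hαβ
      (((continuous_parabolaDeriv κ α β).pow 2).intervalIntegrable _ _)
      intervalIntegrable_const fun t ht => ?_
    refine sq_le_sq' ?_ ?_ <;> unfold parabolaDeriv
    · nlinarith [ht.1, ht.2]
    · nlinarith [ht.1, ht.2]
  rw [intervalIntegral.integral_const, smul_eq_mul] at this
  linarith [this]

/-- Expand the square and integrate the cross term by parts, using that the second derivative of the
parabola is `-κ`. The excess of the limiting action over its minimum thus controls the distance to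
the parabola. -/
theorem HasL2Deriv.integral_sub_parabolaDeriv_sq (hu : HasL2Deriv α β u f) (hαβ : α ≤ β)
    (hα : u α = 0) (hβ : u β = 0) :
    (1 / 2) * ∫ t in α..β, (f t - parabolaDeriv κ α β t) ^ 2 =
      ((1 / 2) * (∫ t in α..β, f t ^ 2) - κ * ∫ t in α..β, u t) -
      ((1 / 2) * (∫ t in α..β, parabolaDeriv κ α β t ^ 2) -
        κ * ∫ t in α..β, parabola κ α β t) := by
  have hP := hasL2Deriv_parabola κ α β
  have hP' : HasL2Deriv α β (parabolaDeriv κ α β) (fun _ => -κ) :=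
    .of_hasDerivAt (continuous_parabolaDeriv κ α β).continuousOn continuousOn_const
      fun t _ => hasDerivAt_parabolaDeriv κ α β t
  have e1 := hP'.integral_mul_eq hαβ hu
  have e2 := hP'.integral_mul_eq hαβ hP
  rw [hα, hβ, intervalIntegral.integral_const_mul] at e1
  rw [parabola_left, parabola_right, intervalIntegral.integral_const_mul] at e2
  have i1 := hu.intervalIntegrable_sq hαβ
  have i2 := hP.intervalIntegrable_sq hαβ
  have i3 := hP.intervalIntegrable_mul hαβ hu
  have e3 : ∫ t in α..β, (f t - parabolaDeriv κ α β t) ^ 2 =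
      ∫ t in α..β, (f t ^ 2 + parabolaDeriv κ α β t ^ 2 - 2 * (parabolaDeriv κ α β t * f t)) :=
    intervalIntegral.integral_congr fun t _ => by ring
  rw [e3, intervalIntegral.integral_sub (i1.add i2) (i3.const_mul 2),
    intervalIntegral.integral_add i1 i2, intervalIntegral.integral_const_mul, e1]
  have e4 : ∫ t in α..β, parabolaDeriv κ α β t ^ 2 =
      ∫ t in α..β, parabolaDeriv κ α β t * parabolaDeriv κ α β t :=
    intervalIntegral.integral_congr fun t _ => by ring
  rw [e4, e2]
  ring

end parabola

/-! ### Distance between the action and its limiting form -/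

section remainder

variable {g q : ℝ → ℝ} {gplus A C : ℝ}

/-- The potential is asymptotically linear. -/
theorem exists_potential_bound (hg : Continuous g) (hm : Monotone g)
    (hlim : Tendsto g atTop (𝓝 gplus)) {ε : ℝ} (hε : 0 < ε) :
    ∃ c : ℝ, 0 ≤ c ∧ ∀ s, 0 ≤ s → |gplus * s - potential g s| ≤ ε * s + c := by
  -- Beyond `S` the difference `gplus * s - potential g s` has slope at most `ε`; on `[0, S]` it is
  -- at most `(gplus - g 0) * S`.
  obtain ⟨S, hS0, hS⟩ : ∃ S, 0 ≤ S ∧ gplus - ε ≤ g S := by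
    obtain ⟨S, hS⟩ := ((hlim.eventually (lt_mem_nhds (sub_lt_self gplus hε))).and
      (eventually_ge_atTop 0)).exists
    exact ⟨S, hS.2, hS.1.le⟩
  have hle : ∀ s, g s ≤ gplus := fun s => hm.ge_of_tendsto hlim s
  have hc : 0 ≤ (gplus - g 0) * S := mul_nonneg (sub_nonneg.2 (hle 0)) hS0
  refine ⟨|(gplus - ε) * S - potential g S| + (gplus - g 0) * S, by positivity, fun s hs => ?_⟩
  have h1 := potential_add_mul_le hg hm s 0
  rw [potential_zero] at h1
  have h3 : 0 ≤ gplus * s - potential g s := by nlinarith [hle s]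
  rw [abs_of_nonneg h3]
  rcases le_total S s with h | h
  · have h2 := potential_add_mul_le hg hm S s
    have h4 := mul_le_mul_of_nonneg_right hS (sub_nonneg.2 h)
    have h5 := le_abs_self ((gplus - ε) * S - potential g S)
    nlinarith
  · have h2 := potential_add_mul_le hg hm 0 s
    rw [potential_zero] at h2
    have h4 := mul_le_mul_of_nonneg_left h (sub_nonneg.2 (hle 0))
    have h5 := abs_nonneg ((gplus - ε) * S - potential g S)
    have h6 := mul_nonneg hε.le hs
    nlinarith

theorem DualNehari.IsDecomposition.ae_abs_sub_le {ε : ℝ} {q₁ q₂ : ℝ → ℝ} (hε : 0 < ε)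
    (h : IsDecomposition q A ε q₁ q₂) : ∀ᵐ t, |q₁ t - A| ≤ ε / 2 := by
  filter_upwards [ae_le_eLpNormEssSup (f := fun t => q₁ t - A) (μ := volume)] with t ht
  rw [← eLpNorm_exponent_top] at ht
  have := ENNReal.toReal_mono (by simp) (ht.trans h.close.le)
  rw [ENNReal.toReal_ofReal (by linarith)] at this
  simpa using this

theorem ae_abs_le_of_eLpNorm_le {q : ℝ → ℝ} {Q : ℝ≥0∞} (hQ : Q ≠ ∞)
    (hq : eLpNorm q ∞ volume ≤ Q) : ∀ᵐ t, |q t| ≤ Q.toReal := by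
  filter_upwards [ae_le_eLpNormEssSup (f := q) (μ := volume)] with t ht
  rw [← eLpNorm_exponent_top] at ht
  simpa using ENNReal.toReal_mono hQ (ht.trans hq)

/-- The action of a function with energy of order `(β - α)³` is close to that of the asymptotic
problem with constant force `gplus - A`. -/
theorem HasL2Deriv.abs_action_sub_le {ε c M k α β : ℝ} {q₁ q₂ v f : ℝ → ℝ}
    (hv : HasL2Deriv α β v f) (hαβ : α < β) (hα : v α = 0) (hβ : v β = 0)
    (hv0 : ∀ t ∈ Icc α β, 0 ≤ v t) (hg : Continuous g) (hq : MemLp q ∞ volume) (hε : 0 < ε)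
    (hc : ∀ s, 0 ≤ s → |gplus * s - potential g s| ≤ ε * s + c)
    (hdec : IsDecomposition q A ε q₁ q₂) (hM : ∀ᵐ t, |q₂ t| ≤ M)
    (hk : ∫ t in α..β, f t ^ 2 ≤ k * (β - α) ^ 3) :
    |action g q α β v - ((1 / 2) * (∫ t in α..β, f t ^ 2) -
        (gplus - A) * ∫ t in α..β, v t)| ≤
      3 / 4 * ε * (1 + k) * (β - α) ^ 3 + c * (β - α) + M * ((1 + k) / 2) * (β - α) ^ 2 := by
  have hl : 0 < β - α := sub_pos.2 hαβ
  have hM0 : 0 ≤ M := by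
    obtain ⟨t, ht⟩ := hM.exists
    exact (abs_nonneg _).trans ht
  set S := ∫ t in α..β, |f t| with hS
  have hS0 : 0 ≤ S := intervalIntegral.integral_nonneg hαβ.le fun t _ => abs_nonneg _
  have hSle : S ≤ (1 + k) / 2 * (β - α) ^ 2 := by
    refine (hv.integral_abs_le hαβ.le hl).trans ?_
    have : (∫ t in α..β, f t ^ 2) / (β - α) ≤ k * (β - α) ^ 2 := by
      rw [div_le_iff₀ hl]; linarith
    linarith
  have hvS : ∀ t ∈ Icc α β, v t ≤ S := fun t ht => (le_abs_self _).trans (hv.abs_le hα ht)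
  have hvi : IntervalIntegrable v volume α β :=
    ContinuousOn.intervalIntegrable (by rw [uIcc_of_le hαβ.le]; exact hv.continuousOn)
  have hpi := hv.intervalIntegrable_potential hαβ.le hg
  have hqi := intervalIntegrable_of_memLp_top hq α β
  have hq1i := intervalIntegrable_of_memLp_top hdec.memLp_fst α β
  have hvc : ContinuousOn v (uIcc α β) := by rw [uIcc_of_le hαβ.le]; exact hv.continuousOn
  have hq2 : HasL2Deriv α β q₂ (fun t => q t - q₁ t) := by
    refine ⟨?_, fun t _ => by linarith [hdec.primitive α t]⟩
    exact ((hq.sub hdec.memLp_fst).restrict _).mono_exponent le_top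
  -- The oscillating part `q - q₁` is moved onto the derivative of `v`. Since `q₂` is bounded and `∫
  -- |f|` has order `(β - α)²`, it contributes below the leading order `(β - α)³`.
  have byparts := hq2.integral_mul_eq hαβ.le hv
  rw [hα, hβ] at byparts
  have split : action g q α β v - ((1 / 2) * (∫ t in α..β, f t ^ 2) -
      (gplus - A) * ∫ t in α..β, v t) =
      (∫ t in α..β, (gplus * v t - potential g (v t))) + (∫ t in α..β, (q₁ t - A) * v t) -
        ∫ t in α..β, q₂ t * f t := by
    have e1 : ∫ t in α..β, q t * v t = (∫ t in α..β, (q₁ t - A) * v t) +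
        (∫ t in α..β, (q t - q₁ t) * v t) + ∫ t in α..β, A * v t := by
      rw [← intervalIntegral.integral_add, ← intervalIntegral.integral_add]
      · exact intervalIntegral.integral_congr fun t _ => by ring
      · exact ((hq1i.sub intervalIntegrable_const).mul_continuousOn hvc).add
          ((hqi.sub hq1i).mul_continuousOn hvc)
      · exact hvi.const_mul A
      · exact (hq1i.sub intervalIntegrable_const).mul_continuousOn hvc
      · exact (hqi.sub hq1i).mul_continuousOn hvc
    rw [hv.action_eq_add hαβ.le hg hq, e1, intervalIntegral.integral_const_mul,
      intervalIntegral.integral_sub (hvi.const_mul _) hpi, intervalIntegral.integral_const_mul]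
    linarith
  have b1 : |∫ t in α..β, (gplus * v t - potential g (v t))| ≤ (ε * S + c) * (β - α) := by
    have := intervalIntegral.norm_integral_le_of_norm_le_const (a := α) (b := β)
      (f := fun t => gplus * v t - potential g (v t)) (C := ε * S + c) fun t ht => by
        rw [uIoc_of_le hαβ.le] at ht
        have ht' := Ioc_subset_Icc_self ht
        refine (hc _ (hv0 t ht')).trans ?_
        have := mul_le_mul_of_nonneg_left (hvS t ht') hε.le
        linarith
    rwa [abs_of_pos hl, Real.norm_eq_abs] at this
  have b2 : |∫ t in α..β, (q₁ t - A) * v t| ≤ ε / 2 * S * (β - α) := by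
    have := intervalIntegral.norm_integral_le_of_norm_le_const_ae (a := α) (b := β)
      (f := fun t => (q₁ t - A) * v t) (C := ε / 2 * S) (by
        filter_upwards [hdec.ae_abs_sub_le hε] with t h1 ht
        rw [uIoc_of_le hαβ.le] at ht
        have ht' := Ioc_subset_Icc_self ht
        rw [Real.norm_eq_abs, abs_mul, abs_of_nonneg (hv0 t ht')]
        exact mul_le_mul h1 (hvS t ht') (hv0 t ht') (by linarith))
    rwa [abs_of_pos hl, Real.norm_eq_abs] at this
  have b3 : |∫ t in α..β, q₂ t * f t| ≤ M * S := by
    have hfi := hv.intervalIntegrable (left_mem_Icc.2 hαβ.le) (right_mem_Icc.2 hαβ.le)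
    rw [hS, ← intervalIntegral.integral_const_mul]
    refine intervalIntegral.norm_integral_le_of_norm_le (μ := volume) (f := fun t => q₂ t * f t)
      (g := fun t => M * |f t|) hαβ.le ?_ (hfi.abs.const_mul M)
    filter_upwards [hM] with t ht _
    rw [Real.norm_eq_abs, abs_mul]
    exact mul_le_mul_of_nonneg_right ht (abs_nonneg _)
  rw [split]
  have b4 : 3 / 2 * ε * S * (β - α) ≤ 3 / 2 * ε * ((1 + k) / 2 * (β - α) ^ 2) * (β - α) := by
    gcongr
  have b5 : M * S ≤ M * ((1 + k) / 2 * (β - α) ^ 2) := by gcongr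
  calc _ ≤ |∫ t in α..β, (gplus * v t - potential g (v t))| +
        |∫ t in α..β, (q₁ t - A) * v t| + |∫ t in α..β, q₂ t * f t| :=
        (abs_sub _ _).trans (add_le_add_left (abs_add_le _ _) _)
    _ ≤ 3 / 2 * ε * S * (β - α) + c * (β - α) + M * S := by linarith
    _ ≤ _ := by linarith

end remainder

/-! ### Approximation by parabolas and the threshold length -/

section threshold

variable {g p : ℝ → ℝ} {gplus A C Q K : ℝ} {p₁ p₂ : ℝ → ℝ → ℝ}

/-- On long intervals, functions whose action is at most that of the parabola are close to it,
uniformly in the forcing class. -/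
theorem exists_length_abs_sub_parabola_le (hg : Continuous g) (hm : Monotone g)
    (hC : ∀ s, |g s| ≤ C) (hlim : Tendsto g atTop (𝓝 gplus)) (hA : A < gplus)
    (hdec : IsDecompositionFamily p A p₁ p₂) (hK : 0 < K) (hCQ : C + Q ≤ K)
    (hκK : gplus - A ≤ K) {ρ : ℝ} (hρ : 0 < ρ) :
    ∃ l : ℝ, 0 < l ∧ ∀ q ∈ forcingClass p A p₂, (∀ᵐ t, |q t| ≤ Q) → ∀ α β : ℝ, l ≤ β - α →
      ∀ u f : ℝ → ℝ, HasL2Deriv α β u f → u α = 0 → u β = 0 → (∀ t ∈ Icc α β, 0 ≤ u t) →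
      action g q α β u ≤ 0 →
      action g q α β u ≤ action g q α β (parabola (gplus - A) α β) →
      ∀ t ∈ Icc α β, |u t - parabola (gplus - A) α β t| ≤ ρ * (β - α) ^ 2 := by
  set κ := gplus - A with hκ
  have hκ0 : 0 < κ := sub_pos.2 hA
  set k := 4 * K ^ 2 with hk
  have hk0 : 0 ≤ k := by positivity
  -- The two remainders, for `u` and for the parabola, have total cubic coefficient `3/2 * ε * (1 +
  -- k)`; half of the budget `ρ²/2` is reserved for it.
  obtain ⟨ε, hε0, hε1, hε⟩ : ∃ ε : ℝ, 0 < ε ∧ ε < 1 ∧ 3 / 2 * ε * (1 + k) ≤ ρ ^ 2 / 4 := by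
    refine ⟨min (1 / 2) (ρ ^ 2 / (6 * (1 + k))), by positivity,
      (min_le_left _ _).trans_lt (by norm_num), ?_⟩
    have h1 : min (1 / 2) (ρ ^ 2 / (6 * (1 + k))) ≤ ρ ^ 2 / (6 * (1 + k)) := min_le_right _ _
    calc 3 / 2 * min (1 / 2) (ρ ^ 2 / (6 * (1 + k))) * (1 + k)
        ≤ 3 / 2 * (ρ ^ 2 / (6 * (1 + k))) * (1 + k) := by gcongr
      _ = ρ ^ 2 / 4 := by field_simp; norm_num
  obtain ⟨c, hc0, hc⟩ := exists_potential_bound hg hm hlim hε0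
  have hfin : eLpNorm (p₂ ε) ∞ volume + 1 ≠ ∞ :=
    ENNReal.add_ne_top.2 ⟨(hdec ε ⟨hε0, hε1⟩).memLp_snd.2.ne, ENNReal.one_ne_top⟩
  set M := (eLpNorm (p₂ ε) ∞ volume + 1).toReal with hM
  have hM0 : 0 ≤ M := ENNReal.toReal_nonneg
  -- The other half absorbs the lower-order terms; length at least `1` lets the linear one be
  -- bounded by a quadratic one. The constant `M` depends on `p₂ ε` only, whence uniformity over the
  -- class.
  refine ⟨max 1 ((2 * c + M * (1 + k)) * (4 / ρ ^ 2)), by positivity, ?_⟩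
  intro q hq hQ α β hl u f hu hα hβ hu0 hact0 hactP t ht
  have hl1 : 1 ≤ β - α := (le_max_left _ _).trans hl
  have hl2 := (le_max_right _ _).trans hl
  have hl0 : 0 < β - α := by linarith
  have hαβ : α < β := by linarith
  obtain ⟨hqm, -, -, hqd⟩ := hq
  obtain ⟨q₁, q₂, hd, hd2⟩ := hqd ε ⟨hε0, hε1⟩
  have hqM := ae_abs_le_of_eLpNorm_le hfin hd2.le
  have hP := hasL2Deriv_parabola κ α β
  have hDu : ∫ t in α..β, f t ^ 2 ≤ k * (β - α) ^ 3 := by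
    have := hu.integral_sq_le hαβ hg hC hqm hQ hK hCQ hα
    rw [hk]
    linarith
  have hDP : ∫ t in α..β, parabolaDeriv κ α β t ^ 2 ≤ k * (β - α) ^ 3 := by
    refine (integral_parabolaDeriv_sq_le hκ0.le hαβ.le).trans ?_
    have : κ ^ 2 ≤ k := by rw [hk]; nlinarith
    gcongr
  have Ru := hu.abs_action_sub_le hαβ hα hβ hu0 hg hqm hε0 hc hd hqM hDu
  have RP := hP.abs_action_sub_le hαβ (parabola_left _ _ _) (parabola_right _ _ _)
    (fun t ht => parabola_nonneg hκ0.le ht) hg hqm hε0 hc hd hqM hDP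
  have id := hu.integral_sub_parabolaDeriv_sq (κ := κ) hαβ.le hα hβ
  have main : ∫ t in α..β, (f t - parabolaDeriv κ α β t) ^ 2 ≤ ρ ^ 2 * (β - α) ^ 3 := by
    have h1 := (abs_le.1 Ru).1
    have h2 := (abs_le.1 RP).2
    have h3 : 3 / 2 * ε * (1 + k) * (β - α) ^ 3 ≤ ρ ^ 2 / 4 * (β - α) ^ 3 := by gcongr
    have h4 : c * (β - α) ≤ c * (β - α) ^ 2 := by
      have : (β - α) ≤ (β - α) ^ 2 := by nlinarith
      gcongr
    have h5 : 2 * c + M * (1 + k) ≤ ρ ^ 2 / 4 * (β - α) := by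
      rw [mul_div_assoc', div_le_iff₀ (by positivity)] at hl2
      linarith
    have h6 : (2 * c + M * (1 + k)) * (β - α) ^ 2 ≤ ρ ^ 2 / 4 * (β - α) * (β - α) ^ 2 := by
      gcongr
    linarith
  have hsub := hu.sub hP
  refine (hsub.abs_le (by simp [hα, parabola_left]) ht).trans
    ((hsub.integral_abs_le hαβ.le (c := ρ * (β - α)) (by positivity)).trans ?_)
  have : (∫ t in α..β, (f t - parabolaDeriv κ α β t) ^ 2) / (ρ * (β - α)) ≤
      ρ * (β - α) ^ 2 := by
    rw [div_le_iff₀ (by positivity)]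
    linarith
  linarith

/-- Existence of a threshold length for the forcing class. -/
theorem exists_isThreshold (hg : Continuous g) (hm : Monotone g)
    (hC : ∀ s, |g s| ≤ C) (hlim : Tendsto g atTop (𝓝 gplus)) (hA : A < gplus)
    (hp : MemLp p ∞ volume) (hdec : IsDecompositionFamily p A p₁ p₂) :
    ∃ L, IsThreshold g (forcingClass p A p₂) L := by
  have hfin : eLpNorm p ∞ volume + 1 ≠ ∞ :=
    ENNReal.add_ne_top.2 ⟨hp.2.ne, ENNReal.one_ne_top⟩
  set Q := (eLpNorm p ∞ volume + 1).toReal with hQ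
  have hQ0 : 0 ≤ Q := ENNReal.toReal_nonneg
  have hC0 : 0 ≤ C := (abs_nonneg _).trans (hC 0)
  set κ := gplus - A with hκ
  have hκ0 : 0 < κ := sub_pos.2 hA
  set K := C + Q + κ with hKdef
  have hK : 0 < K := by positivity
  -- At relative distance `θ` from a zero the quadratic bound `2K(θd)²` equals `κθd²/8`, while the
  -- parabola is at least `15κθd²/32`; the gap exceeds the tolerance `κθd²/16`.
  set θ := κ / (16 * K) with hθ
  have hθ0 : 0 < θ := by positivity
  have hθK : θ * K = κ / 16 := by rw [hθ]; field_simp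
  have hθ1 : θ ≤ 1 / 16 := by
    rw [hθ, div_le_div_iff₀ (by positivity) (by norm_num)]
    linarith
  obtain ⟨l, hl0, hl⟩ := exists_length_abs_sub_parabola_le hg hm hC hlim hA hdec hK
    (Q := Q) (by linarith) (by linarith) (ρ := κ * θ / 16) (by positivity)
  -- Any interior point leaves at least half of the interval on one of its sides.
  refine ⟨2 * l, by linarith, fun a b hab q hq u hu => ?_⟩
  have hab0 : a < b := by linarith
  have hqQ := ae_abs_le_of_eLpNorm_le hfin hq.2.1.le
  have hqK : ∀ᵐ t, ∀ x, q t - g x ≤ K := by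
    filter_upwards [hqQ] with t ht x
    linarith [le_abs_self (q t), neg_abs_le (g x), hC x]
  have hU := hu.hasL2Deriv hab0.le
  have close : ∀ α β, a ≤ α → β ≤ b → l ≤ β - α → u α = 0 → u β = 0 → ∀ t ∈ Icc α β,
      |u t - parabola κ α β t| ≤ κ * θ / 16 * (β - α) ^ 2 := by
    intro α β hα hβ hlen hα0 hβ0
    have hαβ : α ≤ β := by linarith
    refine hl q hq hqQ α β hlen u _ (hU.mono hα hβ) hα0 hβ0
      (fun t ht => hu.1.2 t ⟨hα.trans ht.1, ht.2.trans hβ⟩) ?_ ?_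
    · rw [← action_zero g q α β]
      exact hu.action_le hg hq.1 hα hαβ hβ (f := fun _ => 0)
        (.of_hasDerivAt continuousOn_const continuousOn_const fun t _ => hasDerivAt_const t 0)
        hα0.symm hβ0.symm fun _ _ => le_rfl
    · exact hu.action_le hg hq.1 hα hαβ hβ (hasL2Deriv_parabola _ _ _)
        (by rw [parabola_left, hα0]) (by rw [parabola_right, hβ0])
        fun t ht => parabola_nonneg hκ0.le ht
  have hgap : ∀ d x : ℝ, 0 < d → x ≤ 2 * K * θ ^ 2 * d ^ 2 →
      ¬ |x - κ / 2 * (θ * d * (d - θ * d))| ≤ κ * θ / 16 * d ^ 2 := by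
    intro d x hd hx habs
    have h1 := (abs_le.1 habs).1
    have h2 : 2 * K * θ ^ 2 * d ^ 2 = κ / 8 * (θ * d ^ 2) := by
      have : 2 * K * θ ^ 2 * d ^ 2 = 2 * (θ * K) * (θ * d ^ 2) := by ring
      rw [this, hθK]; ring
    have h3 : 0 < κ * (θ * d ^ 2) := by positivity
    have h4 : θ * (κ * (θ * d ^ 2)) ≤ 1 / 16 * (κ * (θ * d ^ 2)) := by gcongr
    nlinarith
  intro t ht
  by_contra hneg
  have ht0 : u t = 0 := le_antisymm (not_lt.1 hneg) (hu.1.2 t (Ioo_subset_Icc_self ht))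
  rcases le_total ((b - a) / 2) (b - t) with hside | hside
  · have hd : 0 < b - t := by linarith
    set d := b - t with hdd
    have hθd : θ * d ≤ 1 / 16 * d := by gcongr
    have hθd0 : 0 < θ * d := by positivity
    -- The left foot of the tent may have to stop at `a`. Only the sign of `u` there is used, so any
    -- width up to `θ * d` will do.
    set s := max a (t - θ * d) with hs
    have hst : s < t := max_lt ht.1 (by linarith)
    have hsa : a ≤ s := le_max_left _ _
    have hst' : t - θ * d ≤ s := le_max_right _ _
    have h := hu.le_of_zero hg hm hq.1 hqK hsa hst (e := t + θ * d) (by linarith)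
      (by linarith) ht0
    have hs0 : 0 ≤ u s / (t - s) := div_nonneg (hu.1.2 s ⟨hsa, by linarith [ht.2]⟩) (by linarith)
    rw [abs_of_pos hK, add_sub_cancel_left] at h
    have h2 : u (t + θ * d) / (θ * d) ≤ K * (2 * (θ * d)) := by
      refine (le_add_of_nonneg_left hs0).trans (h.trans ?_)
      gcongr
      linarith
    rw [div_le_iff₀ hθd0] at h2
    have hcl := close t b ht.1.le le_rfl (by linarith) ht0 hu.1.1.2.2 (t + θ * d)
      ⟨by linarith, by linarith⟩
    refine hgap d (u (t + θ * d)) hd (by linarith) ?_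
    have e : parabola κ t b (t + θ * d) = κ / 2 * (θ * d * (d - θ * d)) := by
      rw [parabola, hdd]; ring
    rwa [e] at hcl
  · have hd : 0 < t - a := by linarith [ht.1]
    set d := t - a with hdd
    have hθd : θ * d ≤ 1 / 16 * d := by gcongr
    have hθd0 : 0 < θ * d := by positivity
    set e := min b (t + θ * d) with he
    have hte : t < e := lt_min ht.2 (by linarith)
    have heb : e ≤ b := min_le_left _ _
    have het : e ≤ t + θ * d := min_le_right _ _
    have h := hu.le_of_zero hg hm hq.1 hqK (s := t - θ * d) (by linarith) (by linarith) hte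
      heb ht0
    have he0 : 0 ≤ u e / (e - t) := div_nonneg (hu.1.2 e ⟨by linarith [ht.1], heb⟩) (by linarith)
    rw [abs_of_pos hK, sub_sub_cancel] at h
    have h2 : u (t - θ * d) / (θ * d) ≤ K * (2 * (θ * d)) := by
      refine (le_add_of_nonneg_right he0).trans (h.trans ?_)
      gcongr
      linarith
    rw [div_le_iff₀ hθd0] at h2
    have hcl := close a t le_rfl ht.2.le (by linarith) hu.1.1.2.1 ht0 (t - θ * d)
      ⟨by linarith, by linarith⟩
    refine hgap d (u (t - θ * d)) hd (by linarith) ?_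
    have e : parabola κ a t (t - θ * d) = κ / 2 * (θ * d * (d - θ * d)) := by
      rw [parabola, hdd]; ring
    rwa [e] at hcl

end threshold

/-! ### Nodal intervals and Sturm comparison -/

/-- A continuous function vanishing at both ends of `[a,b]` and positive somewhere is positive on
an interval between two zeros. -/
theorem exists_nodal_interval {z : ℝ → ℝ} {a b t₀ : ℝ} (hz : ContinuousOn z (Icc a b))
    (ha : z a = 0) (hb : z b = 0) (ht₀ : t₀ ∈ Icc a b) (hpos : 0 < z t₀) :
    ∃ α β, a ≤ α ∧ α < β ∧ β ≤ b ∧ z α = 0 ∧ z β = 0 ∧ ∀ t ∈ Ioo α β, 0 < z t := by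
  have hl : Icc a t₀ ⊆ Icc a b := Icc_subset_Icc le_rfl ht₀.2
  have hr : Icc t₀ b ⊆ Icc a b := Icc_subset_Icc ht₀.1 le_rfl
  have c1 : IsCompact (Icc a t₀ ∩ z ⁻¹' {0}) :=
    isCompact_Icc.of_isClosed_subset
      ((hz.mono hl).preimage_isClosed_of_isClosed isClosed_Icc isClosed_singleton) inter_subset_left
  have c2 : IsCompact (Icc t₀ b ∩ z ⁻¹' {0}) :=
    isCompact_Icc.of_isClosed_subset
      ((hz.mono hr).preimage_isClosed_of_isClosed isClosed_Icc isClosed_singleton) inter_subset_left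
  -- The last zero before `t₀` and, next, the first one after it; a nonpositive value in between
  -- would produce a closer zero.
  obtain ⟨α, ⟨hα, hzα⟩, hαmax⟩ := c1.exists_isGreatest ⟨a, ⟨le_rfl, ht₀.1⟩, ha⟩
  obtain ⟨β, ⟨hβ, hzβ⟩, hβmin⟩ := c2.exists_isLeast ⟨b, ⟨ht₀.2, le_rfl⟩, hb⟩
  simp only [mem_preimage, mem_singleton_iff] at hzα hzβ
  have h1 : α < t₀ := lt_of_le_of_ne hα.2 fun h => by rw [h] at hzα; exact hpos.ne' hzα
  have h2 : t₀ < β := lt_of_le_of_ne hβ.1 fun h => by rw [← h] at hzβ; exact hpos.ne' hzβ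
  refine ⟨α, β, hα.1, h1.trans h2, hβ.2, hzα, hzβ, fun t ht => ?_⟩
  by_contra hneg
  rw [not_lt] at hneg
  rcases le_total t t₀ with h | h
  · obtain ⟨s, hs, hs0⟩ := intermediate_value_Icc h
      (hz.mono (Icc_subset_Icc (hα.1.trans ht.1.le) ht₀.2)) ⟨hneg, hpos.le⟩
    have := hαmax ⟨⟨hα.1.trans (ht.1.le.trans hs.1), hs.2⟩, hs0⟩
    linarith [ht.1, hs.1]
  · obtain ⟨s, hs, hs0⟩ := intermediate_value_Icc' h
      (hz.mono (Icc_subset_Icc ht₀.1 (ht.2.le.trans hβ.2))) ⟨hneg, hpos.le⟩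
    have := hβmin ⟨⟨hs.1, hs.2.trans (ht.2.le.trans hβ.2)⟩, hs0⟩
    linarith [ht.2, hs.2]

/-- Sturm comparison: a function cannot have a positive arch over which a nonnegative
supersolution is available. -/
theorem false_of_positive_arch {w w' W z z' Z : ℝ → ℝ} {α β : ℝ} (hαβ : α < β)
    (hw : ∀ t ∈ Icc α β, HasDerivAt w (w' t) t) (hw' : ∀ t ∈ Icc α β, HasDerivAt w' (W t) t)
    (hz : ∀ t ∈ Icc α β, HasDerivAt z (z' t) t) (hz' : ∀ t ∈ Icc α β, HasDerivAt z' (Z t) t)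
    (hα : z α = 0) (hβ : z β = 0) (hpos : ∀ t ∈ Ioo α β, 0 < z t) (hwα : 0 ≤ w α)
    (hwβ : 0 ≤ w β) (hWZ : ∀ t ∈ Ioo α β, W t * z t - w t * Z t < 0) : False := by
  -- The Wronskian `w' z - w z'` is strictly decreasing, yet at the ends it equals `-w z'`, which is
  -- nonpositive at `α` and nonnegative at `β`.
  have hN : ∀ t ∈ Icc α β, HasDerivAt (fun t => w' t * z t - w t * z' t)
      (W t * z t - w t * Z t) t := fun t ht =>
    (((hw' t ht).mul (hz t ht)).sub ((hw t ht).mul (hz' t ht))).congr_deriv (by ring)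
  have hanti : StrictAntiOn (fun t => w' t * z t - w t * z' t) (Icc α β) := by
    refine strictAntiOn_of_deriv_neg (convex_Icc α β)
      (fun t ht => (hN t ht).continuousAt.continuousWithinAt) fun t ht => ?_
    rw [interior_Icc] at ht
    rw [(hN t (Ioo_subset_Icc_self ht)).deriv]
    exact hWZ t ht
  have hlt := hanti (left_mem_Icc.2 hαβ.le) (right_mem_Icc.2 hαβ.le) hαβ
  simp only [hα, hβ, mul_zero, zero_sub] at hlt
  have d1 : 0 ≤ z' α := by
    have h := (hasDerivAt_iff_tendsto_slope.1 (hz α (left_mem_Icc.2 hαβ.le))).mono_left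
      (nhdsWithin_mono α (s := Ioi α) fun x hx => (ne_of_gt hx : x ≠ α))
    refine ge_of_tendsto h ?_
    filter_upwards [Ioo_mem_nhdsGT hαβ] with t ht
    rw [slope_def_field, hα, sub_zero]
    exact div_nonneg (hpos t ht).le (by linarith [ht.1])
  have d2 : z' β ≤ 0 := by
    have h := (hasDerivAt_iff_tendsto_slope.1 (hz β (right_mem_Icc.2 hαβ.le))).mono_left
      (nhdsWithin_mono β (s := Iio β) fun x hx => (ne_of_lt hx : x ≠ β))
    refine le_of_tendsto h ?_
    filter_upwards [Ioo_mem_nhdsLT hαβ] with t ht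
    rw [slope_def_field, hβ, sub_zero]
    exact div_nonpos_of_nonneg_of_nonpos (hpos t ht).le (by linarith [ht.2])
  have e1 := mul_nonneg hwα d1
  have e2 := mul_nonneg hwβ (neg_nonneg.2 d2)
  linarith

/-! ### Monotone dependence on the force -/

section comparison

variable {g p u v : ℝ → ℝ} {a b δ : ℝ}

theorem HasL2Deriv.action_add_const {u f : ℝ → ℝ} (hu : HasL2Deriv a b u f) (hab : a ≤ b)
    (hg : Continuous g) (hp : MemLp p ∞ volume) (δ : ℝ) :
    action g (fun t => p t + δ) a b u = action g p a b u + δ * ∫ t in a..b, u t := by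
  have hpδ : MemLp (fun t => p t + δ) ∞ volume := hp.add (memLp_top_const δ)
  have hui : IntervalIntegrable u volume a b :=
    ContinuousOn.intervalIntegrable (by rw [uIcc_of_le hab]; exact hu.continuousOn)
  rw [hu.action_eq_add hab hg hp, hu.action_eq_add hab hg hpδ, add_assoc]
  congr 1
  rw [← intervalIntegral.integral_const_mul δ u,
    ← intervalIntegral.integral_add (hu.intervalIntegrable_force hab hp) (hui.const_mul δ)]
  exact intervalIntegral.integral_congr fun t _ => by ring

/-- Increasing the force decreases the nonnegative minimizers. -/
theorem DualNehari.IsNonnegMinimizer.le_of_add_const (hu : IsNonnegMinimizer g p a b u)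
    (hv : IsNonnegMinimizer g (fun t => p t + δ) a b v) (hab : a ≤ b) (hδ : 0 < δ)
    (hg : Continuous g) (hp : MemLp p ∞ volume) : ∀ t ∈ Icc a b, v t ≤ u t := by
  intro t₀ ht₀
  by_contra! hlt
  have hpδ : MemLp (fun t => p t + δ) ∞ volume := hp.add (memLp_top_const δ)
  have hU := hu.hasL2Deriv hab
  have hV := hv.hasL2Deriv hab
  obtain ⟨α, β, hα, hαβ, hβ, zα, zβ, zpos⟩ := exists_nodal_interval (z := fun t => v t - u t)
    (hV.continuousOn.sub hU.continuousOn) (by simp [hu.1.1.2.1, hv.1.1.2.1])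
    (by simp [hu.1.1.2.2, hv.1.1.2.2]) ht₀ (sub_pos.2 hlt)
  have hU' := hU.mono hα hβ
  have hV' := hV.mono hα hβ
  have mem : ∀ t ∈ Icc α β, t ∈ Icc a b := fun t ht => ⟨hα.trans ht.1, ht.2.trans hβ⟩
  -- Each function competes with the other on the arch. Adding the two inequalities leaves `δ ∫ (v -
  -- u) ≤ 0`, against `v > u` there.
  have h1 := hu.action_le hg hp hα hαβ.le hβ hV' (sub_eq_zero.1 zα) (sub_eq_zero.1 zβ)
    fun t ht => hv.1.2 t (mem t ht)
  have h2 := hv.action_le hg hpδ hα hαβ.le hβ hU' (sub_eq_zero.1 zα).symm (sub_eq_zero.1 zβ).symm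
    fun t ht => hu.1.2 t (mem t ht)
  rw [hV'.action_add_const hαβ.le hg hp, hU'.action_add_const hαβ.le hg hp] at h2
  have hui : IntervalIntegrable u volume α β :=
    ContinuousOn.intervalIntegrable (by rw [uIcc_of_le hαβ.le]; exact hU'.continuousOn)
  have hvi : IntervalIntegrable v volume α β :=
    ContinuousOn.intervalIntegrable (by rw [uIcc_of_le hαβ.le]; exact hV'.continuousOn)
  have h3 : 0 < ∫ t in α..β, (v t - u t) :=
    intervalIntegral.intervalIntegral_pos_of_pos_on (hvi.sub hui) zpos hαβ
  rw [intervalIntegral.integral_sub hvi hui] at h3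
  have h4 := mul_pos hδ h3
  linarith

end comparison

/-! ### Regularity for the linearized equation -/

section linearization

variable {a b : ℝ}

/-- An `H²` solution of `ψ̈ + c ψ = 0` with `ψ(a) = 0` and continuous `c` is classical. -/
theorem DualNehari.MemH2.exists_classical {ψ c : ℝ → ℝ} (hab : a < b) (hψ : MemH2 a b ψ)
    (hψa : ψ a = 0) (hc : ContinuousOn c (Icc a b))
    (heq : ∀ᵐ t ∂(volume.restrict (Ioo a b)), deriv (deriv ψ) t + c t * ψ t = 0) :
    ∃ Ψ Ψ' : ℝ → ℝ, EqOn Ψ ψ (Icc a b) ∧ (∀ t, HasDerivAt Ψ (Ψ' t) t) ∧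
      ∀ t ∈ Icc a b, HasDerivAt Ψ' (-(c t * Ψ t)) t := by
  obtain ⟨hψc, y, hy, hψy⟩ := hψ
  have hY := HasL2Deriv.of_memH1 hab.le hy
  set E : ℝ → ℝ := IccExtend hab.le ((Icc a b).domRestrict fun t => -(c t * ψ t)) with hE
  have hEc : Continuous E := (continuousOn_iff_continuous_domRestrict.1
    (hc.mul hψc).neg).Icc_extend'
  have hEu : ∀ t ∈ Icc a b, E t = -(c t * ψ t) := fun t ht => by
    simp [hE, IccExtend_of_mem _ _ ht, Set.domRestrict_apply]
  have hyE : ∀ᵐ t ∂(volume.restrict (Ioo a b)), deriv y t = E t := by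
    filter_upwards [heq, ae_restrict_mem measurableSet_Ioo] with t ht htab
    have h1 : deriv ψ =ᶠ[𝓝 t] y := by
      filter_upwards [Ioo_mem_nhds htab.1 htab.2] with s hs
      exact (hψy s hs).deriv
    rw [h1.deriv_eq] at ht
    rw [hEu t (Ioo_subset_Icc_self htab)]
    linarith
  -- The derivative `y` is absolutely continuous and its own derivative is almost everywhere the
  -- continuous `E`, so `y` is a classical primitive of `E` on `[a,b]`.
  set Ψ' : ℝ → ℝ := fun t => y a + ∫ s in a..t, E s with hΨ'
  have hΨ'd : ∀ t, HasDerivAt Ψ' (E t) t := fun t =>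
    (intervalIntegral.integral_hasDerivAt_right (hEc.intervalIntegrable _ _)
      (hEc.stronglyMeasurableAtFilter _ _) hEc.continuousAt).const_add _
  have hΨ'c : Continuous Ψ' := continuous_iff_continuousAt.2 fun t => (hΨ'd t).continuousAt
  have hΨ'y : EqOn Ψ' y (Icc a b) := by
    intro t ht
    rw [hY.eq_integral t ht, hΨ']
    simp only
    congr 1
    rw [intervalIntegral.integral_of_le ht.1, intervalIntegral.integral_of_le ht.1]
    refine integral_congr_ae ?_
    rw [← restrict_Ioo_eq_restrict_Ioc]
    filter_upwards [ae_mono (Measure.restrict_mono (Ioo_subset_Ioo_right ht.2) le_rfl) hyE] with s hs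
    exact hs.symm
  have hΨψ : EqOn (fun t => ∫ s in a..t, Ψ' s) ψ (Icc a b) := by
    intro t ht
    rw [(HasL2Deriv.of_hasDerivAt hψc hY.continuousOn hψy).eq_integral t ht, hψa, zero_add]
    refine intervalIntegral.integral_congr fun s hs => ?_
    rw [uIcc_of_le ht.1] at hs
    exact hΨ'y ⟨hs.1, hs.2.trans ht.2⟩
  refine ⟨fun t => ∫ s in a..t, Ψ' s, Ψ', hΨψ, fun t =>
    intervalIntegral.integral_hasDerivAt_right (hΨ'c.intervalIntegrable _ _)
      (hΨ'c.stronglyMeasurableAtFilter _ _) hΨ'c.continuousAt, fun t ht => ?_⟩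
  rw [hΨψ ht, ← hEu t ht]
  exact hΨ'd t

end linearization

/-! ### Uniqueness, non-degeneracy and classical solutions -/

section main

variable {g p u v : ℝ → ℝ} {a b δ : ℝ}

/-- Two positive minimizers for the same force are ordered, in either order, as soon as a force
larger by a constant admits a positive minimizer. -/
theorem le_of_positive_minimizers {u₁ : ℝ → ℝ} (hg : Continuous g) (hm : Monotone g)
    (hconc : ConcaveOn ℝ (Ioi 0) g) (hpc : Continuous p) (hp : MemLp p ∞ volume) (hab : a < b)
    (hδ : 0 < δ) (hu : IsNonnegMinimizer g p a b u) (hupos : ∀ t ∈ Ioo a b, 0 < u t)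
    (hu₁ : IsNonnegMinimizer g p a b u₁) (hu₁pos : ∀ t ∈ Ioo a b, 0 < u₁ t)
    (hv : IsNonnegMinimizer g (fun t => p t + δ) a b v) (hvpos : ∀ t ∈ Ioo a b, 0 < v t) :
    ∀ t ∈ Icc a b, u₁ t ≤ u t := by
  intro t₀ ht₀
  by_contra! hlt
  have hvu := hu.le_of_add_const hv hab.le hδ hg hp
  have hpδ : MemLp (fun t => p t + δ) ∞ volume := hp.add (memLp_top_const δ)
  obtain ⟨U, U', hU, hUd, hUd'⟩ := hu.exists_classical hg hm hp hpc hab hupos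
  obtain ⟨U₁, U₁', hU₁, hU₁d, hU₁d'⟩ := hu₁.exists_classical hg hm hp hpc hab hu₁pos
  obtain ⟨V, V', hV, hVd, hVd'⟩ :=
    hv.exists_classical hg hm hpδ (hpc.add continuous_const) hab hvpos
  have ha := left_mem_Icc.2 hab.le
  have hb := right_mem_Icc.2 hab.le
  have hc : Continuous fun t => U₁ t - U t := continuous_iff_continuousAt.2 fun t =>
    ((hU₁d t).sub (hUd t)).continuousAt
  obtain ⟨α, β, hα, hαβ, hβ, zα, zβ, zpos⟩ := exists_nodal_interval (z := fun t => U₁ t - U t)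
    hc.continuousOn (by simp [hU₁ ha, hU ha, hu.1.1.2.1, hu₁.1.1.2.1])
    (by simp [hU₁ hb, hU hb, hu.1.1.2.2, hu₁.1.1.2.2]) ht₀
    (by rw [hU₁ ht₀, hU ht₀]; exact sub_pos.2 hlt)
  have mem : ∀ t ∈ Icc α β, t ∈ Icc a b := fun t ht => ⟨hα.trans ht.1, ht.2.trans hβ⟩
  have hw0 : ∀ t ∈ Icc α β, 0 ≤ U t - V t := fun t ht => by
    rw [hU (mem t ht), hV (mem t ht)]; exact sub_nonneg.2 (hvu t (mem t ht))
  refine false_of_positive_arch hαβ (w := fun t => U t - V t) (w' := fun t => U' t - V' t)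
    (W := fun t => (p t - g (U t)) - (p t + δ - g (V t)))
    (z := fun t => U₁ t - U t) (z' := fun t => U₁' t - U' t)
    (Z := fun t => (p t - g (U₁ t)) - (p t - g (U t)))
    (fun t _ => (hUd t).sub (hVd t)) (fun t ht => (hUd' t (mem t ht)).sub (hVd' t (mem t ht)))
    (fun t _ => (hU₁d t).sub (hUd t)) (fun t ht => (hU₁d' t (mem t ht)).sub (hUd' t (mem t ht)))
    zα zβ zpos (hw0 α (left_mem_Icc.2 hαβ.le)) (hw0 β (right_mem_Icc.2 hαβ.le)) fun t ht => ?_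
  have hz := zpos t ht
  have hw := hw0 t (Ioo_subset_Icc_self ht)
  have hto : t ∈ Ioo a b := ⟨hα.trans_lt ht.1, ht.2.trans_le hβ⟩
  have htc := Ioo_subset_Icc_self hto
  have hVp : 0 < V t := by rw [hV htc]; exact hvpos t hto
  have hU1p : 0 < U₁ t := by rw [hU₁ htc]; exact hu₁pos t hto
  -- Chord slopes of the concave `g` decrease along `V t ≤ U t < U₁ t`. If `U t = V t`, both sides
  -- vanish.
  have key : (g (U₁ t) - g (U t)) * (U t - V t) ≤ (g (U t) - g (V t)) * (U₁ t - U t) := by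
    rcases eq_or_lt_of_le hw with h | h
    · rw [← h, show V t = U t by linarith]; simp
    · have := hconc.slope_anti_adjacent (x := V t) (y := U t) (z := U₁ t) hVp hU1p
        (by linarith) (by linarith)
      rwa [div_le_div_iff₀ hz h] at this
  have h5 := mul_pos hδ hz
  have e : (p t - g (U t) - (p t + δ - g (V t))) * (U₁ t - U t) -
      (U t - V t) * (p t - g (U₁ t) - (p t - g (U t))) =
      (g (U₁ t) - g (U t)) * (U t - V t) - (g (U t) - g (V t)) * (U₁ t - U t) -
        δ * (U₁ t - U t) := by ring
  rw [e]
  linarith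

/-- Positive minimizers are non-degenerate as soon as a force larger by a constant admits a
positive minimizer. -/
theorem isNondegenerate_of_positive_minimizers (hg : ContDiff ℝ 1 g) (hm : Monotone g)
    (hconc : ConcaveOn ℝ (Ioi 0) g) (hpc : Continuous p) (hp : MemLp p ∞ volume) (hab : a < b)
    (hδ : 0 < δ) (hu : IsNonnegMinimizer g p a b u) (hupos : ∀ t ∈ Ioo a b, 0 < u t)
    (hv : IsNonnegMinimizer g (fun t => p t + δ) a b v) (hvpos : ∀ t ∈ Ioo a b, 0 < v t) :
    IsNondegenerate g a b u := by
  have hgc := hg.continuous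
  have hvu := hu.le_of_add_const hv hab.le hδ hgc hp
  have hpδ : MemLp (fun t => p t + δ) ∞ volume := hp.add (memLp_top_const δ)
  obtain ⟨U, U', hU, hUd, hUd'⟩ := hu.exists_classical hgc hm hp hpc hab hupos
  obtain ⟨V, V', hV, hVd, hVd'⟩ :=
    hv.exists_classical hgc hm hpδ (hpc.add continuous_const) hab hvpos
  have hcc : ContinuousOn (fun t => deriv g (u t)) (Icc a b) :=
    (hg.continuous_deriv le_rfl).comp_continuousOn (hu.hasL2Deriv hab.le).continuousOn
  intro ψ hψ2 hψ0 hψeq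
  obtain ⟨Ψ, Ψ', hΨ, hΨd, hΨd'⟩ := hψ2.exists_classical hab hψ0.2.1 hcc hψeq
  have ha := left_mem_Icc.2 hab.le
  have hb := right_mem_Icc.2 hab.le
  -- The equation is linear, so the signs `σ = 1` and `σ = -1` together rule out both positive and
  -- negative arches.
  have nonpos : ∀ σ : ℝ, ∀ t ∈ Icc a b, σ * Ψ t ≤ 0 := by
    intro σ t₀ ht₀
    by_contra! hlt
    have hc : Continuous fun t => σ * Ψ t := continuous_iff_continuousAt.2 fun t =>
      ((hΨd t).const_mul σ).continuousAt
    obtain ⟨α, β, hα, hαβ, hβ, zα, zβ, zpos⟩ := exists_nodal_interval (z := fun t => σ * Ψ t)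
      hc.continuousOn (by simp [hΨ ha, hψ0.2.1]) (by simp [hΨ hb, hψ0.2.2]) ht₀ hlt
    have mem : ∀ t ∈ Icc α β, t ∈ Icc a b := fun t ht => ⟨hα.trans ht.1, ht.2.trans hβ⟩
    have hw0 : ∀ t ∈ Icc α β, 0 ≤ U t - V t := fun t ht => by
      rw [hU (mem t ht), hV (mem t ht)]; exact sub_nonneg.2 (hvu t (mem t ht))
    refine false_of_positive_arch hαβ (w := fun t => U t - V t) (w' := fun t => U' t - V' t)
      (W := fun t => (p t - g (U t)) - (p t + δ - g (V t)))
      (z := fun t => σ * Ψ t) (z' := fun t => σ * Ψ' t)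
      (Z := fun t => σ * -(deriv g (u t) * Ψ t))
      (fun t _ => (hUd t).sub (hVd t)) (fun t ht => (hUd' t (mem t ht)).sub (hVd' t (mem t ht)))
      (fun t _ => (hΨd t).const_mul σ) (fun t ht => (hΨd' t (mem t ht)).const_mul σ)
      zα zβ zpos (hw0 α (left_mem_Icc.2 hαβ.le)) (hw0 β (right_mem_Icc.2 hαβ.le)) fun t ht => ?_
    have hz := zpos t ht
    have hw := hw0 t (Ioo_subset_Icc_self ht)
    have hto : t ∈ Ioo a b := ⟨hα.trans_lt ht.1, ht.2.trans_le hβ⟩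
    have htc := Ioo_subset_Icc_self hto
    have hVp : 0 < V t := by rw [hV htc]; exact hvpos t hto
    have hUp : 0 < U t := by rw [hU htc]; exact hupos t hto
    -- By concavity the tangent at `U t` is no steeper than the chord from `V t`; this makes `U - V`
    -- a strict supersolution of the linearized equation.
    have key : deriv g (U t) * (U t - V t) ≤ g (U t) - g (V t) := by
      rcases eq_or_lt_of_le hw with h | h
      · rw [← h, show V t = U t by linarith]; simp
      · have := hconc.deriv_le_slope (x := V t) (y := U t) hVp hUp (by linarith)
          (hg.differentiable (by norm_num) _)
        rwa [slope_def_field, le_div_iff₀ h] at this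
    rw [← hU htc]
    have h5 := mul_pos hδ hz
    have h6 := mul_le_mul_of_nonneg_right key hz.le
    have e : (p t - g (U t) - (p t + δ - g (V t))) * (σ * Ψ t) -
        (U t - V t) * (σ * -(deriv g (U t) * Ψ t)) =
        deriv g (U t) * (U t - V t) * (σ * Ψ t) - (g (U t) - g (V t)) * (σ * Ψ t) -
          δ * (σ * Ψ t) := by ring
    rw [e]
    linarith
  intro t ht
  rw [← hΨ ht]
  linarith [nonpos 1 t ht, nonpos (-1) t ht]

theorem DualNehari.IsNonnegMinimizer.solvesPositiveBVP (hu : IsNonnegMinimizer g p a b u)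
    (hg : Continuous g) (hm : Monotone g) (hp : MemLp p ∞ volume) (hpc : Continuous p)
    (hab : a < b) (hpos : ∀ t ∈ Ioo a b, 0 < u t) : SolvesPositiveBVP g p a b u := by
  obtain ⟨U, U', hU, hUd, hUd'⟩ := hu.exists_classical hg hm hp hpc hab hpos
  have hUo : EqOn U u (Ioo a b) := hU.mono Ioo_subset_Icc_self
  have hdU : deriv U = U' := funext fun t => (hUd t).deriv
  have hdu : EqOn (deriv u) U' (Ioo a b) := fun t ht => by
    have : u =ᶠ[𝓝 t] U := by
      filter_upwards [Ioo_mem_nhds ht.1 ht.2] with s hs using (hUo hs).symm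
    rw [this.deriv_eq, hdU]
  have hddu : ∀ t ∈ Ioo a b, deriv (deriv u) t = p t - g (U t) := fun t ht => by
    have : deriv u =ᶠ[𝓝 t] U' := by
      filter_upwards [Ioo_mem_nhds ht.1 ht.2] with s hs using hdu hs
    rw [this.deriv_eq, (hUd' t (Ioo_subset_Icc_self ht)).deriv]
  have hUc : Continuous U := continuous_iff_continuousAt.2 fun t => (hUd t).continuousAt
  refine ⟨(hu.hasL2Deriv hab.le).continuousOn, ?_, fun t ht => ?_, hu.1.1.2.1, hu.1.1.2.2, hpos⟩
  · have h1 : ContDiffOn ℝ 1 U' (Ioo a b) := by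
      rw [show (1 : WithTop ℕ∞) = 0 + 1 by norm_num, contDiffOn_succ_iff_deriv_of_isOpen isOpen_Ioo]
      refine ⟨fun t ht => (hUd' t (Ioo_subset_Icc_self ht)).differentiableAt.differentiableWithinAt,
        by simp, ?_⟩
      rw [contDiffOn_zero]
      exact (hpc.sub (hg.comp hUc)).continuousOn.congr fun t ht =>
        (hUd' t (Ioo_subset_Icc_self ht)).deriv
    have h2 : ContDiffOn ℝ 2 U (Ioo a b) := by
      rw [show (2 : WithTop ℕ∞) = 1 + 1 by norm_num, contDiffOn_succ_iff_deriv_of_isOpen isOpen_Ioo]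
      exact ⟨fun t _ => (hUd t).differentiableAt.differentiableWithinAt, by simp, by rwa [hdU]⟩
    exact h2.congr fun t ht => (hUo ht).symm
  · rw [hddu t ht, hUo ht]
    ring

end main

/-! ### Decompositions and perturbations of the forcing term -/

section forcing

variable {p : ℝ → ℝ} {A : ℝ} {p₁ p₂ : ℝ → ℝ → ℝ}

theorem memLp_top_of_continuous_bounded (hpc : Continuous p) {C : ℝ} (hC : ∀ t, |p t| ≤ C) :
    MemLp p ∞ volume :=
  memLp_top_of_bound hpc.aestronglyMeasurable C (ae_of_all _ hC)

/-- A bounded continuous function with an asymptotic average has decompositions: averaging over a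
long window gives the part close to the average. -/
theorem exists_isDecomposition (hpc : Continuous p) {C : ℝ} (hC : ∀ t, |p t| ≤ C)
    (hA : HasAsymptoticAverage p A) {ε : ℝ} (hε : 0 < ε) :
    ∃ q₁ q₂, IsDecomposition p A ε q₁ q₂ := by
  -- The tolerance `ε/4` leaves room for the strict bound `ε/2` on the essential supremum.
  obtain ⟨T, hT, hT0⟩ := (((Metric.tendstoUniformly_iff.1 hA) (ε / 4) (by linarith)).and
    (eventually_gt_atTop 0)).exists
  set F : ℝ → ℝ := potential p with hF
  have hFd : ∀ t, HasDerivAt F (p t) t := hasDerivAt_potential hpc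
  have hFc : Continuous F := continuous_potential hpc
  have hFsub : ∀ s t, |F t - F s| ≤ C * |t - s| := fun s t => abs_potential_sub_le hpc hC t s
  set H : ℝ → ℝ := potential F with hH
  have hHd : ∀ t, HasDerivAt H (F t) t := hasDerivAt_potential hFc
  have hHc : Continuous H := continuous_potential hFc
  set q₁ : ℝ → ℝ := fun t => 1 / T * (F (t + T) - F t) with hq₁
  set q₂ : ℝ → ℝ := fun t => F t - 1 / T * (H (t + T) - H t) with hq₂
  have hC0 : 0 ≤ C := (abs_nonneg _).trans (hC 0)
  have hq₁c : Continuous q₁ := by fun_prop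
  have hq₂c : Continuous q₂ := by fun_prop
  have hclose : ∀ t, |q₁ t - A| ≤ ε / 4 := fun t => by
    have h := (hT t).le
    rw [dist_comm, Real.dist_eq] at h
    have e : q₁ t = 1 / T * ∫ s in t..(t + T), p s := by
      simp only [hq₁, hF, potential]
      rw [intervalIntegral.integral_interval_sub_left (hpc.intervalIntegrable _ _)
        (hpc.intervalIntegrable _ _)]
    rwa [e]
  have hb : ∀ t, |q₂ t| ≤ C * T := fun t => by
    have h1 : H (t + T) - H t = ∫ s in t..(t + T), F s := by
      simp only [hH, potential]
      rw [intervalIntegral.integral_interval_sub_left (hFc.intervalIntegrable _ _)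
        (hFc.intervalIntegrable _ _)]
    -- The primitive `F` may be unbounded, but `q₂` only sees its increments over a window of length
    -- `T`.
    have h2 : q₂ t = 1 / T * ∫ s in t..(t + T), (F t - F s) := by
      rw [intervalIntegral.integral_sub intervalIntegrable_const (hFc.intervalIntegrable _ _),
        intervalIntegral.integral_const, smul_eq_mul, ← h1]
      simp only [hq₂]
      field_simp
      ring
    have h3 := intervalIntegral.norm_integral_le_of_norm_le_const (a := t) (b := t + T)
      (f := fun s => F t - F s) (C := C * T) fun s hs => by
        rw [uIoc_of_le (by linarith)] at hs
        refine (hFsub s t).trans (mul_le_mul_of_nonneg_left ?_ hC0)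
        rw [abs_le]
        constructor <;> linarith [hs.1, hs.2]
    rw [add_sub_cancel_left, abs_of_pos hT0, Real.norm_eq_abs] at h3
    rw [h2, abs_mul, abs_of_pos (by positivity : 0 < 1 / T), one_div, inv_mul_le_iff₀ hT0]
    linarith
  refine ⟨q₁, q₂, ?_, ?_, ?_, fun s t => ?_⟩
  · refine memLp_top_of_continuous_bounded hq₁c (C := |A| + ε / 4) fun t => ?_
    have h1 := abs_add_le A (q₁ t - A)
    rw [add_sub_cancel] at h1
    linarith [hclose t]
  · exact memLp_top_of_continuous_bounded hq₂c hb
  · refine lt_of_le_of_lt (b := ENNReal.ofReal (ε / 4)) ?_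
      ((ENNReal.ofReal_lt_ofReal_iff (by linarith)).2 (by linarith))
    rw [eLpNorm_exponent_top]
    refine eLpNormEssSup_le_of_ae_bound (ae_of_all _ hclose)
  · have hd : ∀ x, HasDerivAt q₂ (p x - q₁ x) x := fun x => by
      have h1 := (hHd (x + T)).comp_add_const x T
      exact (hFd x).sub ((h1.sub (hHd x)).const_mul (1 / T))
    exact (intervalIntegral.integral_eq_sub_of_hasDerivAt (fun x _ => hd x)
      ((hpc.sub hq₁c).intervalIntegrable _ _)).symm

theorem self_mem_forcingClass (hp : MemLp p ∞ volume) (hA : HasAsymptoticAverage p A)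
    (hdec : IsDecompositionFamily p A p₁ p₂) : p ∈ forcingClass p A p₂ :=
  ⟨hp, ENNReal.lt_add_right hp.2.ne one_ne_zero, hA, fun ε hε => ⟨p₁ ε, p₂ ε, hdec ε hε,
    ENNReal.lt_add_right (hdec ε hε).memLp_snd.2.ne one_ne_zero⟩⟩

/-- Adding a small constant on a bounded interval stays in the forcing class. -/
theorem add_indicator_mem_forcingClass (hp : MemLp p ∞ volume) (hA : HasAsymptoticAverage p A)
    (hdec : IsDecompositionFamily p A p₁ p₂) {a b δ : ℝ} (hab : a ≤ b) (hδ : 0 < δ)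
    (hδ1 : δ < 1) (hδab : δ * (b - a) < 1) :
    (fun t => p t + (Icc a b).indicator (fun _ => δ) t) ∈ forcingClass p A p₂ := by
  set χ : ℝ → ℝ := (Icc a b).indicator fun _ => δ with hχ
  have hχm : Measurable χ := measurable_const.indicator measurableSet_Icc
  have hχ0 : ∀ t, 0 ≤ χ t := fun t => indicator_nonneg (fun _ _ => hδ.le) t
  have hχδ : ∀ t, ‖χ t‖ ≤ δ := fun t => by
    rw [Real.norm_eq_abs, abs_of_nonneg (hχ0 t)]
    exact indicator_le_self' (fun _ _ => hδ.le) t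
  have hχL : MemLp χ ∞ volume := memLp_top_of_bound hχm.aestronglyMeasurable δ (ae_of_all _ hχδ)
  have hχint : Integrable χ volume :=
    (integrable_indicator_iff measurableSet_Icc).2 (integrableOn_const (by simp))
  have hχi : ∀ s t, IntervalIntegrable χ volume s t := fun s t => hχint.intervalIntegrable
  have htot : ∫ t, χ t = δ * (b - a) := by
    rw [hχ, integral_indicator_const _ measurableSet_Icc]
    simp [hab, mul_comm]
  have hprim : ∀ s t, |∫ x in s..t, χ x| ≤ δ * (b - a) := fun s t => by
    rw [← htot, intervalIntegral.abs_intervalIntegral_eq]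
    rw [abs_of_nonneg (integral_nonneg hχ0)]
    exact setIntegral_le_integral hχint (ae_of_all _ hχ0)
  have lt_add_one : ∀ {x y : ℝ → ℝ} {e : ℝ}, MemLp x ∞ volume → MemLp y ∞ volume → e < 1 →
      (∀ t, ‖y t‖ ≤ e) → eLpNorm (fun t => x t + y t) ∞ volume < eLpNorm x ∞ volume + 1 := by
    intro x y e hx hy he hye
    refine (eLpNorm_add_le hx.1 hy.1 le_top).trans_lt ?_
    refine ENNReal.add_lt_add_left hx.2.ne ?_
    rw [eLpNorm_exponent_top]
    refine (eLpNormEssSup_le_of_ae_bound (ae_of_all _ hye)).trans_lt ?_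
    rw [← ENNReal.ofReal_one]
    exact (ENNReal.ofReal_lt_ofReal_iff one_pos).2 he
  refine ⟨hp.add hχL, lt_add_one hp hχL hδ1 hχδ, ?_, fun ε hε => ?_⟩
  · have hpi : ∀ s t, IntervalIntegrable p volume s t := intervalIntegrable_of_memLp_top hp
    -- The added bump has finite mass, so its means over windows of length `T` are `O(1/T)`,
    -- uniformly in `t`.
    have hlim : Tendsto (fun T : ℝ => 1 / T * (δ * (b - a))) atTop (𝓝 0) := by
      simpa using (tendsto_inv_atTop_zero (𝕜 := ℝ)).mul_const (δ * (b - a))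
    rw [HasAsymptoticAverage, Metric.tendstoUniformly_iff] at hA ⊢
    intro η hη
    filter_upwards [hA (η / 2) (half_pos hη), hlim.eventually (gt_mem_nhds (half_pos hη)),
      eventually_gt_atTop 0] with T h1 h2 h3 t
    have h4 := h1 t
    rw [dist_comm, Real.dist_eq] at h4 ⊢
    rw [intervalIntegral.integral_add (hpi _ _) (hχi _ _)]
    have h5 : |1 / T * ∫ x in t..(t + T), χ x| ≤ 1 / T * (δ * (b - a)) := by
      rw [abs_mul, abs_of_pos (by positivity : 0 < 1 / T)]
      exact mul_le_mul_of_nonneg_left (hprim _ _) (by positivity)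
    have h6 := abs_add_le (1 / T * (∫ x in t..(t + T), p x) - A) (1 / T * ∫ x in t..(t + T), χ x)
    rw [show 1 / T * ((∫ x in t..(t + T), p x) + ∫ x in t..(t + T), χ x) - A =
      (1 / T * (∫ x in t..(t + T), p x) - A) + 1 / T * ∫ x in t..(t + T), χ x by ring]
    linarith
  · have hd := hdec ε hε
    -- The whole bump is put into the derivative part: `p₁ ε` is unchanged, and `p₂ ε` gains a
    -- primitive bounded by the mass `δ * (b - a) < 1`.
    set X : ℝ → ℝ := fun t => ∫ x in a..t, χ x with hX
    have hXc : Continuous X := intervalIntegral.continuous_primitive hχi a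
    have hXb : ∀ t, ‖X t‖ ≤ δ * (b - a) := fun t => hprim a t
    have hXL : MemLp X ∞ volume :=
      memLp_top_of_bound hXc.aestronglyMeasurable _ (ae_of_all _ hXb)
    refine ⟨p₁ ε, fun t => p₂ ε t + X t, ⟨hd.memLp_fst, hd.memLp_snd.add hXL, hd.close,
      fun s t => ?_⟩, lt_add_one hd.memLp_snd hXL hδab hXb⟩
    have e1 : X t - X s = ∫ x in s..t, χ x :=
      intervalIntegral.integral_interval_sub_left (hχi _ _) (hχi _ _)
    have e2 : ∫ x in s..t, (p x + χ x - p₁ ε x) =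
        (∫ x in s..t, (p x - p₁ ε x)) + ∫ x in s..t, χ x := by
      rw [← intervalIntegral.integral_add ((intervalIntegrable_of_memLp_top hp s t).sub
        (intervalIntegrable_of_memLp_top hd.memLp_fst s t)) (hχi s t)]
      exact intervalIntegral.integral_congr fun x _ => by ring
    rw [e2, ← hd.primitive s t, ← e1]
    ring

end forcing

/-! ### Conclusion -/

theorem proposition5 (g : ℝ → ℝ) (hg : IsSaturating g)
    (gminus gplus : ℝ) (hgminus : Tendsto g atBot (𝓝 gminus)) (hgplus : Tendsto g atTop (𝓝 gplus))
    (p : ℝ → ℝ) (hpc : Continuous p) (hpb : ∃ C : ℝ, ∀ t, |p t| ≤ C)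
    (A : ℝ) (hA : HasAsymptoticAverage p A) (hAminus : gminus < A) (hAplus : A < gplus) :
    (∃ p₁ p₂ : ℝ → ℝ → ℝ, IsDecompositionFamily p A p₁ p₂) ∧
    ∀ p₁ p₂ : ℝ → ℝ → ℝ, IsDecompositionFamily p A p₁ p₂ →
      (∃ L : ℝ, IsThreshold g (forcingClass p A p₂) L) ∧
      ∀ L : ℝ, IsThreshold g (forcingClass p A p₂) L → ∀ a b : ℝ, L ≤ b - a →
        ∃ u : ℝ → ℝ, IsNonnegMinimizer g p a b u ∧
          (∀ v : ℝ → ℝ, IsNonnegMinimizer g p a b v → EqOn v u (Icc a b)) ∧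
          SolvesPositiveBVP g p a b u ∧ IsNondegenerate g a b u := by
  obtain ⟨Cp, hCp⟩ := hpb
  obtain ⟨C, hC⟩ := hg.bounded
  have hgc := hg.contDiff.continuous
  have hm := hg.strictMono.monotone
  have hp := memLp_top_of_continuous_bounded hpc hCp
  refine ⟨?_, fun p₁ p₂ hdec => ⟨exists_isThreshold hgc hm hC hgplus hAplus hp hdec,
    fun L hL a b hLab => ?_⟩⟩
  · have h : ∀ ε : ℝ, ∃ q : (ℝ → ℝ) × (ℝ → ℝ), 0 < ε → IsDecomposition p A ε q.1 q.2 := fun ε => by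
      by_cases hε : 0 < ε
      · obtain ⟨q₁, q₂, h⟩ := exists_isDecomposition hpc hCp hA hε
        exact ⟨(q₁, q₂), fun _ => h⟩
      · exact ⟨(0, 0), fun h => absurd h hε⟩
    choose q hq using h
    exact ⟨fun ε => (q ε).1, fun ε => (q ε).2, fun ε hε => hq ε hε.1⟩
  · have hab : a < b := by linarith [hL.1]
    have hl : 0 < b - a := sub_pos.2 hab
    -- Both the height and the mass of the bump must fit into the slack `1` of the norm bounds of
    -- the class.
    obtain ⟨δ, hδ, hδ1, hδab⟩ : ∃ δ : ℝ, 0 < δ ∧ δ < 1 ∧ δ * (b - a) < 1 := by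
      refine ⟨1 / (2 * (1 + (b - a))), by positivity, ?_, ?_⟩
      · rw [div_lt_one (by positivity)]; linarith
      · rw [one_div, inv_mul_lt_iff₀ (by positivity)]; linarith
    have hpos : ∀ w, IsNonnegMinimizer g p a b w → ∀ t ∈ Ioo a b, 0 < w t :=
      hL.2 a b hLab p (self_mem_forcingClass hp hA hdec)
    have hpδ : MemLp (fun t => p t + δ) ∞ volume := hp.add (memLp_top_const δ)
    obtain ⟨u, hu⟩ := exists_isNonnegMinimizer hgc hC hp hab
    obtain ⟨v, hv⟩ := exists_isNonnegMinimizer hgc hC hpδ hab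
    -- The force `p + δ` on the whole line has average `A + δ` and is outside the class. The action
    -- sees only `[a,b]`, so it may be replaced by `p` plus the bump, to which the threshold
    -- property applies.
    have hvpos : ∀ t ∈ Ioo a b, 0 < v t :=
      hL.2 a b hLab _ (add_indicator_mem_forcingClass hp hA hdec hab.le hδ hδ1 hδab) v
        (hv.congr hab.le fun t ht => by simp [indicator_of_mem ht])
    have hconc := hg.strictConcave.concaveOn
    refine ⟨u, hu, fun w hw t ht => ?_, hu.solvesPositiveBVP hgc hm hp hpc hab (hpos u hu),
      isNondegenerate_of_positive_minimizers (hg.contDiff.of_le (by norm_num)) hm hconc hpc hp hab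
        hδ hu (hpos u hu) hv hvpos⟩
    exact le_antisymm
      (le_of_positive_minimizers hgc hm hconc hpc hp hab hδ hu (hpos u hu) hw (hpos w hw) hv hvpos
        t ht)
      (le_of_positive_minimizers hgc hm hconc hpc hp hab hδ hw (hpos w hw) hu (hpos u hu) hv hvpos
        t ht)
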